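/- Let $d\ge 1$, $\beta\in\mathbb{R}$, and let $\nu$ be the law of i.i.d. couplings $J=(J_{xy})$ indexed by the nearest-neighbour edges $\{x,y\}$ of $\mathbb{Z}^d$, with a common symmetric distribution on $\mathbb{R}$. For a box $\Lambda=[a,b]\subset\mathbb{Z}^d$ let $G_{\Lambda,\beta,J}$ be the Edwards–Anderson Gibbs measure on $\{-1,+1\}^{\Lambda}$ with periodic boundary conditions, $G_{\Lambda,\beta,J}(\sigma)=\exp(-\beta H_{\Lambda,J}(\sigma))/Z$ with $H_{\Lambda,J}(\sigma)=-\sum J_{xy}\sigma_x\sigma_y$, the sum being over the edges of the torus obtained from $\Lambda$; the additional edge joining a site $x$ of the upper face in direction $i$ to the opposite site of the lower face carries the coupling $J_{x,x+e_i}$. Let $(\Lambda_n)$ be boxes whose lower corners tend to $-\infty$ and upper corners to $+\infty$ in every coordinate, and let $\kappa=(\kappa_J)$ be a metastate of $(G_{\Lambda_n,\beta,J})_n$: a measurable family of probability measures on the space $\mathcal{M}(\{\pm1\}^{\mathbb{Z}^d})$ of probability measures on $\{\pm1\}^{\mathbb{Z}^d}$ such that, along some subsequence, $$\nu(dJ)\prod_{i\in\mathbb{N}}G_{\Lambda_{n_k},\beta,J}\;\longrightarrow\;\nu(dJ)\int\kappa_J(d\Gamma)\prod_{i\in\mathbb{N}}\Gamma$$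 in the sense of finite-dimensional distributions of the couplings and of the replicas $(\sigma^i)_{i\in\mathbb{N}}$. For finite $W\subset\mathbb{Z}^d$ let $W^*$ be the set of edges with both endpoints in $W$, and let $$R^W(\sigma,\sigma')=\frac1{|W^*|}\sum_{\{x,y\}\in W^*}\sigma_x\sigma_y\sigma'_x\sigma'_y,\qquad R(\sigma,\sigma')=\lim_{W\to\mathbb{Z}^d}R^W(\sigma,\sigma')$$ ($R^W=0$ if $W^*=\emptyset$), where $W\to\mathbb{Z}^d$ means that $W=[a,b]$ runs over boxes with all coordinates of $a$ tending to $-\infty$ and all coordinates of $b$ to $+\infty$, and $R$ has an arbitrary fixed value where the limit does not exist. Let $Q^W_J$ (respectively $Q_J$) be the random $\mathbb{N}\times\mathbb{N}$ matrix with ones on the diagonal and entries $R^W(\sigma^i,\sigma^j)$ (respectively $R(\sigma^i,\sigma^j)$), $i\ne j$, where $(\sigma^i)_{i\in\mathbb{N}}$ has law $\int\kappa_J(d\Gamma)\prod_{i}\Gamma$. Then: 1. For $\nu$-almost all $J$, the limit defining $R(\sigma,\sigma')$ exists for $\kappa_J$-almost all $\Gamma$ and $\Gamma\times\Gamma$-almost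 all $(\sigma,\sigma')$. 2. For $\nu$-almost all $J$, all the $Q^W_J$ ($W\subset\mathbb{Z}^d$ finite) and $Q_J$ are random overlap structures (almost surely symmetric positive semidefinite with unit diagonal, with law invariant under simultaneous permutations of finitely many row and column indices), and $Q^W_J\to Q_J$ in law as $W\to\mathbb{Z}^d$ (for the product topology on matrices). 3. More generally, if $(W_n)$ is any sequence of finite subsets of $\mathbb{Z}^d$ such that for $\nu$-almost all $J$, $\kappa_J$-almost all $\Gamma$ and $\Gamma\times\Gamma$-almost all $(\sigma,\sigma')$ one has $R^{W_n}(\sigma,\sigma')\to R(\sigma,\sigma')$, then $Q^{W_n}_J\to Q_J$ in law for $\nu$-almost all $J$. -/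

import Mathlib

open MeasureTheory ProbabilityTheory Filter Topology

noncomputable section

namespace EA

/-! ### Spins, edges and couplings -/

/-- The sites of the lattice `ℤ^d`. -/
abbrev Site (d : ℕ) := Fin d → ℤ

/-- The nearest-neighbour edges of `ℤ^d`. Each of them is `{x, x + e_i}` for exactly one pair
`(x, i)`, and this pair stands for it. -/
abbrev Edge (d : ℕ) := Site d × Fin d

/-- The second endpoint `x + e_i` of the edge `(x, i)`. -/
def Edge.tip {d : ℕ} (e : Edge d) : Site d := e.1 + Pi.single e.2 1

/-- Spin configurations `σ ∈ {-1,+1}^{ℤ^d}` with the product topology and product `σ`-algebra;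
`true` stands for `+1` and `false` for `-1`. -/
abbrev Config (d : ℕ) := Site d → Bool

/-- The value of a spin in `{-1,+1}`. -/
def spin (s : Bool) : ℝ := if s then 1 else -1

/-- Coupling configurations `J = (J_{xy})`, one real number for each edge of `ℤ^d`. -/
abbrev Coupling (d : ℕ) := Edge d → ℝ

/-- The law `ν` of i.i.d. couplings with common distribution `ρ`. -/
def couplingLaw (d : ℕ) (ρ : ProbabilityMeasure ℝ) : ProbabilityMeasure (Coupling d) :=
  ⟨Measure.infinitePi fun _ : Edge d => (ρ : Measure ℝ), inferInstance⟩

/-! ### Finite-volume Gibbs measures with periodic boundary conditions -/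

/-- The neighbour of `x` in direction `i` in the box `[a, b]` with opposite faces identified. -/
def torusNext {d : ℕ} (a b x : Site d) (i : Fin d) : Site d :=
  Function.update x i (if x i = b i then a i else x i + 1)

/-- The Edwards-Anderson Hamiltonian `H_{Λ,J}(σ) = - ∑ J_{xy} σ_x σ_y` of the box `Λ = [a, b]` with
periodic boundary conditions. The additional edge that joins a site `x` of the upper face in
direction `i` to the opposite site of the lower face carries the coupling of the edge
`{x, x + e_i}` of `ℤ^d`, which has only one endpoint in `Λ` and is otherwise unused; so the edges of
the torus have independent couplings. Only the spins in `Λ` enter. -/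
def hamiltonian {d : ℕ} (a b : Site d) (J : Coupling d) (σ : Config d) : ℝ :=
  -∑ x ∈ Finset.Icc a b, ∑ i : Fin d, J (x, i) * spin (σ x) * spin (σ (torusNext a b x i))

/-- A configuration in `Λ`, completed by `+1` outside `Λ`. (Only spins in windows contained in `Λ`
are ever looked at.) -/
def extend {d : ℕ} (Λ : Finset (Site d)) (τ : Λ → Bool) : Config d :=
  fun x => if h : x ∈ Λ then τ ⟨x, h⟩ else true

/-- The partition function. -/
def partitionFunction {d : ℕ} (β : ℝ) (a b : Site d) (J : Coupling d) : ℝ :=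
  ∑ τ : Finset.Icc a b → Bool, Real.exp (-β * hamiltonian a b J (extend (Finset.Icc a b) τ))

/-- The finite-volume Gibbs measure `G_{Λ,β,J}`: the configuration `τ` in `Λ = [a, b]` has
probability `exp(-β H_{Λ,J}(τ)) / Z`. -/
def gibbsMeasure {d : ℕ} (β : ℝ) (a b : Site d) (J : Coupling d) : Measure (Config d) :=
  ∑ τ : Finset.Icc a b → Bool,
    ENNReal.ofReal (Real.exp (-β * hamiltonian a b J (extend (Finset.Icc a b) τ)) /
      partitionFunction β a b J) • Measure.dirac (extend (Finset.Icc a b) τ)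

theorem partitionFunction_pos {d : ℕ} (β : ℝ) (a b : Site d) (J : Coupling d) :
    0 < partitionFunction β a b J :=
  Finset.sum_pos (fun _ _ => Real.exp_pos _) Finset.univ_nonempty

instance {d : ℕ} (β : ℝ) (a b : Site d) (J : Coupling d) :
    IsProbabilityMeasure (gibbsMeasure β a b J) := by
  refine ⟨?_⟩
  have hZ := partitionFunction_pos β a b J
  simp only [gibbsMeasure, Measure.coe_finsetSum, Finset.sum_apply, Measure.smul_apply,
    measure_univ, smul_eq_mul, mul_one]
  rw [← ENNReal.ofReal_sum_of_nonneg (fun _ _ => by positivity), ← Finset.sum_div]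
  change ENNReal.ofReal (partitionFunction β a b J / _) = 1
  rw [div_self hZ.ne', ENNReal.ofReal_one]

/-- The Gibbs measure as a random element of the space of probability measures. -/
def gibbs {d : ℕ} (β : ℝ) (a b : Site d) (J : Coupling d) : ProbabilityMeasure (Config d) :=
  ⟨gibbsMeasure β a b J, inferInstance⟩

theorem measurable_gibbs {d : ℕ} (β : ℝ) (a b : Site d) :
    Measurable (gibbs β a b : Coupling d → ProbabilityMeasure (Config d)) := by
  refine Measurable.subtype_mk (Measure.measurable_of_measurable_coe _ fun s _ => ?_)
  simp only [gibbsMeasure, Measure.coe_finsetSum, Finset.sum_apply, Measure.smul_apply,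
    smul_eq_mul]
  unfold partitionFunction hamiltonian
  fun_prop

/-! ### Replicas and metastates -/

/-- The kernel `Γ ↦ ∏_{i ∈ ℕ} Γ`: an infinite sequence of independent replicas sampled from `Γ`. -/
def replicas (d : ℕ) : Kernel (ProbabilityMeasure (Config d)) (ℕ → Config d) where
  toFun Γ := Measure.infinitePi fun _ : ℕ => (Γ : Measure (Config d))
  measurable' := by
    refine Measurable.measure_of_isPiSystem_of_isProbabilityMeasure
      generateFrom_squareCylinders.symm
      (isPiSystem_squareCylinders (fun _ => MeasurableSpace.isPiSystem_measurableSet)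
        (fun _ => by simp)) ?_
    rintro _ ⟨s, t, ht, rfl⟩
    have ht' : ∀ i, MeasurableSet (t i) := fun i => ht i (Set.mem_univ i)
    simp only [fun Γ : ProbabilityMeasure (Config d) =>
      Measure.infinitePi_pi (fun _ : ℕ => (Γ : Measure (Config d))) (s := s) (fun i _ => ht' i)]
    exact Finset.measurable_prod _ fun i _ =>
      (Measure.measurable_coe (ht' i)).comp measurable_subtype_coe

instance (d : ℕ) : IsMarkovKernel (replicas d) :=
  ⟨fun Γ => inferInstanceAs
    (IsProbabilityMeasure (Measure.infinitePi fun _ : ℕ => (Γ : Measure (Config d))))⟩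

/-- For a family `κ = (κ_J)` of laws of random states, the law
`∫ κ_J(dΓ) ∏_{i ∈ ℕ} Γ` of the replicas `(σ^i)` at fixed `J`, as a kernel in `J`. -/
def replicaKernel {d : ℕ} (κ : Kernel (Coupling d) (ProbabilityMeasure (Config d))) :
    Kernel (Coupling d) (ℕ → Config d) :=
  replicas d ∘ₖ κ

instance {d : ℕ} (κ : Kernel (Coupling d) (ProbabilityMeasure (Config d))) [IsMarkovKernel κ] :
    IsMarkovKernel (replicaKernel κ) :=
  inferInstanceAs (IsMarkovKernel (replicas d ∘ₖ κ))

/-- The joint law `ν(dJ) ∫ κ_J(dΓ) ∏_{i ∈ ℕ} Γ` of the couplings and the replicas. -/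
def jointLaw {d : ℕ} (ν : ProbabilityMeasure (Coupling d))
    (κ : Kernel (Coupling d) (ProbabilityMeasure (Config d))) [IsMarkovKernel κ] :
    ProbabilityMeasure (Coupling d × (ℕ → Config d)) :=
  ⟨(ν : Measure (Coupling d)) ⊗ₘ replicaKernel κ, inferInstance⟩

/-- The couplings of finitely many edges and the spins of finitely many replicas in a finite
window. -/
def restrict {d : ℕ} (E : Finset (Edge d)) (W : Finset (Site d)) (m : ℕ)
    (p : Coupling d × (ℕ → Config d)) : (E → ℝ) × (Fin m → W → Bool) :=
  (fun e => p.1 e, fun i x => p.2 i x)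

instance {d : ℕ} (E : Finset (Edge d)) (W : Finset (Site d)) (m : ℕ) :
    OpensMeasurableSpace ((E → ℝ) × (Fin m → W → Bool)) :=
  @Prod.opensMeasurableSpace _ _ _ _ _ _ inferInstance inferInstance
    (secondCountableTopologyEither_of_right _ _)

theorem measurable_restrict {d : ℕ} (E : Finset (Edge d)) (W : Finset (Site d)) (m : ℕ) :
    Measurable (restrict E W m : Coupling d × (ℕ → Config d) → _) := by
  unfold restrict
  fun_prop

/-- `κ` is a metastate at inverse temperature `β` of the finite-volume Gibbs measures in the boxes
`Λ_n = [a n, b n]`: along some subsequence, the laws `ν(dJ) ∏_{i ∈ ℕ} G_{Λ_n,β,J}` converge to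
`ν(dJ) ∫ κ_J(dΓ) ∏_{i ∈ ℕ} Γ` in the sense of finite-dimensional distributions. -/
def IsMetastate {d : ℕ} (ν : ProbabilityMeasure (Coupling d)) (β : ℝ) (a b : ℕ → Site d)
    (κ : Kernel (Coupling d) (ProbabilityMeasure (Config d))) [IsMarkovKernel κ] : Prop :=
  ∃ φ : ℕ → ℕ, StrictMono φ ∧
    ∀ (E : Finset (Edge d)) (W : Finset (Site d)) (m : ℕ),
      Tendsto
        (fun k => (jointLaw ν (Kernel.deterministic (gibbs β (a (φ k)) (b (φ k)))
          (measurable_gibbs β (a (φ k)) (b (φ k))))).map (measurable_restrict E W m).aemeasurable)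
        atTop (𝓝 ((jointLaw ν κ).map (measurable_restrict E W m).aemeasurable))

/-! ### Edge overlaps -/

/-- `W^*`, the set of edges with both endpoints in `W`. -/
def innerEdges {d : ℕ} (W : Finset (Site d)) : Finset (Edge d) :=
  (W ×ˢ Finset.univ).filter fun e => e.tip ∈ W

/-- The edge overlap `R^W(σ, σ')` in the finite window `W`. -/
def windowOverlap {d : ℕ} (W : Finset (Site d)) (σ σ' : Config d) : ℝ :=
  ((innerEdges W).card : ℝ)⁻¹ *
    ∑ e ∈ innerEdges W, spin (σ e.1) * spin (σ e.tip) * spin (σ' e.1) * spin (σ' e.tip)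

/-- The limit `W → ℤ^d` over rectangular boxes `W = [a, b]`: all the coordinates of `a` tend to
`-∞` and all those of `b` to `+∞`, independently of each other. -/
def boxes (d : ℕ) : Filter (Finset (Site d)) :=
  ((atBot : Filter (Site d)) ×ˢ (atTop : Filter (Site d))).map fun p => Finset.Icc p.1 p.2

instance (d : ℕ) : (boxes d).IsCountablyGenerated := by
  unfold boxes
  infer_instance

instance (d : ℕ) : (boxes d).NeBot := by
  unfold boxes
  infer_instance

/-- The edge overlap `R(σ, σ')`, the limit of `R^W(σ, σ')` as `W → ℤ^d` (an arbitrary fixed value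
where the limit does not exist). -/
def edgeOverlap {d : ℕ} (σ σ' : Config d) : ℝ :=
  limUnder (boxes d) fun W => windowOverlap W σ σ'

theorem measurable_spin : Measurable spin := measurable_of_finite _

theorem measurable_windowOverlap {d : ℕ} (W : Finset (Site d)) :
    Measurable fun p : Config d × Config d => windowOverlap W p.1 p.2 := by
  have h := measurable_spin
  unfold windowOverlap
  fun_prop

theorem measurable_edgeOverlap {d : ℕ} :
    Measurable fun p : Config d × Config d => edgeOverlap p.1 p.2 :=
  (StronglyMeasurable.limUnder (l := boxes d)
    (fun W => (measurable_windowOverlap W).stronglyMeasurable)).measurable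

/-! ### Random overlap structures -/

/-- The law `P` of a random `ℕ × ℕ` matrix is the law of a random overlap structure: the matrix is
almost surely symmetric positive semidefinite with ones on the diagonal, and its law is invariant
under permutations of finitely many indices (acting simultaneously on rows and columns). -/
def IsROSt (P : ProbabilityMeasure (ℕ → ℕ → ℝ)) : Prop :=
  (∀ᵐ q ∂(P : Measure (ℕ → ℕ → ℝ)), (Matrix.of q).PosSemidef ∧ ∀ i, q i i = 1) ∧
    ∀ π : Equiv.Perm ℕ, {i | π i ≠ i}.Finite →
      (P : Measure (ℕ → ℕ → ℝ)).map (fun q i j => q (π i) (π j)) = P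

/-- The matrix with ones on the diagonal and the overlaps `R(σ^i, σ^j)` off the diagonal. -/
def overlapMatrix {d : ℕ} (R : Config d → Config d → ℝ) (σ : ℕ → Config d) : ℕ → ℕ → ℝ :=
  fun i j => if i = j then 1 else R (σ i) (σ j)

theorem measurable_overlapMatrix {d : ℕ} {R : Config d → Config d → ℝ}
    (hR : Measurable fun p : Config d × Config d => R p.1 p.2) :
    Measurable (overlapMatrix R) := by
  refine measurable_pi_lambda _ fun i => measurable_pi_lambda _ fun j => ?_
  by_cases h : i = j
  · simp [overlapMatrix, h]
  · have h' : Measurable fun σ : ℕ → Config d => (σ i, σ j) :=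
      (measurable_pi_apply i).prodMk (measurable_pi_apply j)
    simpa [overlapMatrix, h, Function.comp_def] using hR.comp h'

/-- The law of the overlap matrix of replicas sampled from `Γ`, which in turn is sampled from
`κ_J`. -/
def overlapLaw {d : ℕ} (κ : Kernel (Coupling d) (ProbabilityMeasure (Config d)))
    [IsMarkovKernel κ] (R : Config d → Config d → ℝ)
    (hR : Measurable fun p : Config d × Config d => R p.1 p.2) (J : Coupling d) :
    ProbabilityMeasure (ℕ → ℕ → ℝ) :=
  ProbabilityMeasure.map ⟨replicaKernel κ J, inferInstance⟩
    (measurable_overlapMatrix hR).aemeasurable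

/-- The law of `Q^W_J`. -/
def windowROSt {d : ℕ} (κ : Kernel (Coupling d) (ProbabilityMeasure (Config d)))
    [IsMarkovKernel κ] (W : Finset (Site d)) (J : Coupling d) : ProbabilityMeasure (ℕ → ℕ → ℝ) :=
  overlapLaw κ (windowOverlap W) (measurable_windowOverlap W) J

/-- The law of `Q_J`. -/
def limitROSt {d : ℕ} (κ : Kernel (Coupling d) (ProbabilityMeasure (Config d)))
    [IsMarkovKernel κ] (J : Coupling d) : ProbabilityMeasure (ℕ → ℕ → ℝ) :=
  overlapLaw κ edgeOverlap measurable_edgeOverlap J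

end EA

end

/-! The periodic Gibbs measures are covariant under rotations of the torus: rotating the spins
amounts to permuting the edges that carry the couplings. The couplings being i.i.d., the law of two
replicas averaged over `J` is therefore invariant under these rotations
(`pairLaw_gibbs_torusShift`). A rotation acts on a fixed window as a translation once the box is
large, so in the limit the averaged law of two replicas of the metastate is invariant under all
translations of the lattice (`measurePreserving_pairShift_single`, `measurePreserving_pairShift`).

Up to boundary terms, the edge overlap in a box is the mean over the directions of spatial averages
of a bounded local function of the two replicas. A multiparameter pointwise ergodic theorem,
`averagesConverge_box`, makes these averages converge almost surely. It has to allow sides that grow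
independently of each other, so it is proved one direction at a time: Birkhoff's theorem gives the
one-parameter case, and `AveragesConverge.comp` handles the inner averages, which vary together with
the outer interval. Disintegrating the averaged law over `J` and `Γ` turns this into the first
claim.

The rest is soft. Window matrices are Gram matrices and replicas are exchangeable, and positivity
survives entrywise limits. The countably many pairs of replicas converge simultaneously, so the
matrices converge almost surely, and hence in law by dominated convergence. This last step uses only
convergence of the overlaps, and so applies to any sequence of windows where that holds. -/

/-! ### The pointwise ergodic theorem -/

namespace MeasureTheory

variable {Ω : Type*}

/-- The maximum of the first Birkhoff sums, defined by recursion. -/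
def birkhoffMax (T : Ω → Ω) (g : Ω → ℝ) : ℕ → Ω → ℝ
  | 0 => fun _ => 0
  | n + 1 => fun x => max 0 (g x + birkhoffMax T g n (T x))

theorem birkhoffMax_nonneg (T : Ω → Ω) (g : Ω → ℝ) (n : ℕ) (x : Ω) :
    0 ≤ birkhoffMax T g n x := by
  cases n with
  | zero => exact le_rfl
  | succ n => exact le_max_left _ _

theorem birkhoffMax_le_succ (T : Ω → Ω) (g : Ω → ℝ) (n : ℕ) (x : Ω) :
    birkhoffMax T g n x ≤ birkhoffMax T g (n + 1) x := by
  induction n generalizing x with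
  | zero => exact le_max_left _ _
  | succ n ih => exact max_le_max le_rfl (by gcongr; exact ih _)

theorem birkhoffSum_le_birkhoffMax (T : Ω → Ω) (g : Ω → ℝ) (n : ℕ) (x : Ω) :
    birkhoffSum T g n x ≤ birkhoffMax T g n x := by
  induction n generalizing x with
  | zero => simp [birkhoffMax]
  | succ n ih =>
    rw [birkhoffSum_succ']
    exact le_max_of_le_right (by gcongr; exact ih _)

/-- Garsia's argument: where the maximum is positive it equals `g` plus the previous maximum at `T
x`, and maxima increase with `n`; where it vanishes, the left side is at most zero. The left side
integrates to zero for invariant `μ`, which is the maximal inequality. -/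
theorem birkhoffMax_sub_le_indicator (T : Ω → Ω) (g : Ω → ℝ) (n : ℕ) (x : Ω) :
    birkhoffMax T g n x - birkhoffMax T g n (T x) ≤
      {x | 0 < birkhoffMax T g n x}.indicator g x := by
  by_cases h : 0 < birkhoffMax T g n x
  · rw [Set.indicator_of_mem (by exact h)]
    cases n with
    | zero => simp [birkhoffMax] at h
    | succ n =>
      have h1 : birkhoffMax T g (n + 1) x = g x + birkhoffMax T g n (T x) := by
        refine max_eq_right (le_of_not_gt fun hlt => ?_)
        have : birkhoffMax T g (n + 1) x = 0 := max_eq_left hlt.le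
        exact h.ne' this
      have h2 := birkhoffMax_le_succ T g n (T x)
      linarith
  · rw [Set.indicator_of_notMem (by exact h)]
    have := birkhoffMax_nonneg T g n (T x)
    linarith

variable [MeasurableSpace Ω] {μ : Measure Ω} {T : Ω → Ω}

theorem measurable_birkhoffMax (hT : Measurable T) {g : Ω → ℝ} (hg : Measurable g) (n : ℕ) :
    Measurable (birkhoffMax T g n) := by
  induction n with
  | zero => exact measurable_const
  | succ n ih => exact measurable_const.max (hg.add (ih.comp hT))

theorem integrable_birkhoffMax (hT : MeasurePreserving T μ μ) {g : Ω → ℝ} (hg : Integrable g μ)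
    (n : ℕ) : Integrable (birkhoffMax T g n) μ := by
  induction n with
  | zero => exact integrable_zero _ _ _
  | succ n ih => exact (integrable_zero _ _ _).sup (hg.add (hT.integrable_comp_of_integrable ih))

theorem measurable_birkhoffSum (hT : Measurable T) {g : Ω → ℝ} (hg : Measurable g) (n : ℕ) :
    Measurable (birkhoffSum T g n) :=
  Finset.measurable_sum _ fun k _ => hg.comp (hT.iterate k)

/-- The maximal ergodic theorem, for functions of which almost every orbit has a positive
Birkhoff sum. -/
theorem integral_nonneg_of_ae_exists_birkhoffSum_pos (hT : MeasurePreserving T μ μ) {g : Ω → ℝ}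
    (hgm : Measurable g) (hg : Integrable g μ) (h : ∀ᵐ x ∂μ, ∃ n, 0 < birkhoffSum T g n x) :
    0 ≤ ∫ x, g x ∂μ := by
  have hms : ∀ n, MeasurableSet {x | 0 < birkhoffMax T g n x} := fun n =>
    measurableSet_lt measurable_const (measurable_birkhoffMax hT.measurable hgm n)
  have hn : ∀ n, 0 ≤ ∫ x, {x | 0 < birkhoffMax T g n x}.indicator g x ∂μ := fun n => by
    have hi := integrable_birkhoffMax hT hg n
    have hi' : Integrable (fun x => birkhoffMax T g n (T x)) μ :=
      hT.integrable_comp_of_integrable hi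
    calc (0 : ℝ) = ∫ x, (birkhoffMax T g n x - birkhoffMax T g n (T x)) ∂μ := by
          rw [integral_sub hi hi', ← integral_map hT.measurable.aemeasurable
            (f := birkhoffMax T g n) (by rw [hT.map_eq]; exact hi.1), hT.map_eq, sub_self]
      _ ≤ _ := integral_mono (hi.sub hi') (hg.indicator (hms n))
          (birkhoffMax_sub_le_indicator T g n)
  -- The sets where the maxima are positive increase to almost the whole space, so the indicators
  -- disappear in the limit.
  refine ge_of_tendsto' (tendsto_integral_of_dominated_convergence (fun x => ‖g x‖)
    (fun n => (hg.indicator (hms n)).1) hg.norm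
    (fun n => Eventually.of_forall fun x => norm_indicator_le_norm_self _ _) ?_) hn
  filter_upwards [h] with x ⟨N, hN⟩
  refine tendsto_const_nhds.congr' ?_
  filter_upwards [eventually_ge_atTop N] with n hNn
  have hmono : Monotone fun n => birkhoffMax T g n x :=
    monotone_nat_of_le_succ fun n => birkhoffMax_le_succ T g n x
  exact (Set.indicator_of_mem (s := {x | 0 < birkhoffMax T g n x})
    (hN.trans_le ((birkhoffSum_le_birkhoffMax T g N x).trans (hmono hNn))) g).symm

/-- One half of the pointwise ergodic theorem. -/
theorem ae_bddAbove_birkhoffSum_sub_condExp [IsFiniteMeasure μ] (hT : MeasurePreserving T μ μ)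
    {f : Ω → ℝ} (hfm : Measurable f) (hf : Integrable f μ) {ε : ℝ} (hε : 0 < ε) :
    ∀ᵐ x ∂μ, BddAbove (Set.range fun n : ℕ =>
      birkhoffSum T f n x - n * (μ[f|MeasurableSpace.invariants T] x + ε)) := by
  set F : Ω → ℝ := μ[f|MeasurableSpace.invariants T] with hF
  have hle := MeasurableSpace.invariants_le T
  have hFm' : Measurable[MeasurableSpace.invariants T] F := stronglyMeasurable_condExp.measurable
  have hFm : Measurable F := hFm'.mono hle le_rfl
  have hFT : F ∘ T = F := MeasurableSpace.comp_eq_of_measurable_invariants hFm'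
  set g : Ω → ℝ := fun x => f x - (F x + ε) with hg
  have hgm : Measurable g := hfm.sub (hFm.add_const ε)
  have hgi : Integrable g μ := hf.sub (integrable_condExp.add (integrable_const ε))
  have hsum : ∀ n x, birkhoffSum T g n x = birkhoffSum T f n x - n * (F x + ε) := by
    intro n x
    have h1 := birkhoffSum_sub T f (fun x => F x + ε) n x
    have h2 := congrFun (birkhoffSum_of_comp_eq (f := T) (φ := fun x => F x + ε)
      (funext fun y => congrArg (· + ε) (congrFun hFT y)) n) x
    rw [h2] at h1
    refine h1.trans ?_
    simp [mul_add]
  -- The sums at `x` and at `T x` differ by the single term `g x`, so boundedness is an invariant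
  -- event; the `max 0` below covers the empty sum.
  have hinv : T ⁻¹' {x | BddAbove (Set.range fun n => birkhoffSum T g n x)} =
      {x | BddAbove (Set.range fun n => birkhoffSum T g n x)} := by
    ext x
    simp only [Set.mem_preimage, Set.mem_ofPred_eq, bddAbove_def, Set.forall_mem_range]
    constructor
    · rintro ⟨C, hC⟩
      refine ⟨max 0 (g x + C), fun n => ?_⟩
      cases n with
      | zero => simp
      | succ n => rw [birkhoffSum_succ']; exact le_max_of_le_right (by gcongr; exact hC n)
    · rintro ⟨C, hC⟩
      refine ⟨C - g x, fun n => ?_⟩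
      have := hC (n + 1)
      rw [birkhoffSum_succ'] at this
      linarith
  have hmeas : MeasurableSet {x | BddAbove (Set.range fun n => birkhoffSum T g n x)} :=
    measurableSet_bddAbove_range fun n => measurable_birkhoffSum hT.measurable hgm n
  set E : Set Ω := {x | BddAbove (Set.range fun n => birkhoffSum T g n x)}ᶜ with hE
  have hEm : MeasurableSet E := hmeas.compl
  have hEinv : T ⁻¹' E = E := by rw [hE, Set.preimage_compl, hinv]
  have hTE : MeasurePreserving T (μ.restrict E) (μ.restrict E) := by
    have := hT.restrict_preimage hEm
    rwa [hEinv] at this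
  have hpos : 0 ≤ ∫ x in E, g x ∂μ := by
    refine integral_nonneg_of_ae_exists_birkhoffSum_pos hTE hgm hgi.restrict ?_
    filter_upwards [ae_restrict_mem hEm] with x hx
    by_contra! hcon
    exact hx ⟨0, by rintro _ ⟨n, rfl⟩; exact hcon n⟩
  -- As `E` is invariant, `f` and its conditional expectation have the same integral over it. Only
  -- the margin `ε` is left, and against `hpos` it forces `E` to be null.
  have hint : ∫ x in E, g x ∂μ = -(ε * μ.real E) := by
    have hFi : Integrable F μ := integrable_condExp
    have hc : Integrable (fun _ : Ω => ε) μ := integrable_const ε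
    calc ∫ x in E, g x ∂μ = ∫ x in E, f x ∂μ - ∫ x in E, (F x + ε) ∂μ :=
          integral_sub hf.integrableOn (hFi.add hc).integrableOn
      _ = ∫ x in E, f x ∂μ - (∫ x in E, F x ∂μ + ∫ _ in E, ε ∂μ) := by
          rw [integral_add hFi.integrableOn hc.integrableOn]
      _ = -(ε * μ.real E) := by
          rw [hF, setIntegral_condExp hle hf ⟨hEm, hEinv⟩]
          simp [mul_comm]
  have hzero : μ E = 0 := by
    have h0 : μ.real E = 0 := by
      have := measureReal_nonneg (μ := μ) (s := E)
      nlinarith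
    exact (measureReal_eq_zero_iff (measure_ne_top _ _)).1 h0
  filter_upwards [measure_eq_zero_iff_ae_notMem.1 hzero] with x hx
  simpa only [hE, Set.mem_compl_iff, not_not, Set.mem_ofPred_eq, hsum] using hx

/-- An upper bound `C` on the compensated sums contributes only `C / n` to the average, which the
gap between `ε` and a smaller margin `u k` absorbs. Margins from a sequence keep the exceptional
sets countable in number. -/
theorem ae_limsup_birkhoffAverage_le [IsFiniteMeasure μ] (hT : MeasurePreserving T μ μ)
    {f : Ω → ℝ} (hfm : Measurable f) (hf : Integrable f μ) :
    ∀ᵐ x ∂μ, ∀ ε > 0, ∀ᶠ n : ℕ in atTop,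
      birkhoffAverage ℝ T f n x < μ[f|MeasurableSpace.invariants T] x + ε := by
  obtain ⟨u, -, hu0, hu⟩ := exists_seq_strictAnti_tendsto (0 : ℝ)
  filter_upwards [ae_all_iff.2 fun k : ℕ =>
    ae_bddAbove_birkhoffSum_sub_condExp hT hfm hf (hu0 k)] with x hx ε hε
  obtain ⟨k, hk⟩ := (hu.eventually_lt_const hε).exists
  obtain ⟨C, hC⟩ := hx k
  obtain ⟨N, hN⟩ := exists_nat_gt (C / (ε - u k))
  filter_upwards [eventually_ge_atTop (max N 1)] with n hn
  have hn1 : (1 : ℝ) ≤ n := by exact_mod_cast (le_max_right _ _).trans hn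
  have hnN : (N : ℝ) ≤ n := by exact_mod_cast (le_max_left _ _).trans hn
  have h1 := hC ⟨n, rfl⟩
  have h2 : C < n * (ε - u k) := by
    rw [div_lt_iff₀ (by linarith)] at hN
    nlinarith
  simp only [birkhoffAverage, smul_eq_mul]
  rw [inv_mul_lt_iff₀ (by linarith)]
  simp only at h1
  nlinarith

/-- **Birkhoff's pointwise ergodic theorem.** -/
theorem ae_tendsto_birkhoffAverage [IsFiniteMeasure μ] (hT : MeasurePreserving T μ μ)
    {f : Ω → ℝ} (hfm : Measurable f) (hf : Integrable f μ) :
    ∀ᵐ x ∂μ, Tendsto (fun n : ℕ => birkhoffAverage ℝ T f n x) atTop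
      (𝓝 (μ[f|MeasurableSpace.invariants T] x)) := by
  -- The lower bound is the upper bound for `-f`.
  filter_upwards [ae_limsup_birkhoffAverage_le hT hfm hf,
    ae_limsup_birkhoffAverage_le hT hfm.neg hf.neg,
    condExp_neg f (MeasurableSpace.invariants T) (μ := μ)] with x h1 h2 h3
  rw [Metric.tendsto_nhds]
  intro ε hε
  filter_upwards [h1 ε hε, h2 ε hε] with n h1 h2
  rw [h3] at h2
  simp only [birkhoffAverage, birkhoffSum_neg, Pi.neg_apply, smul_eq_mul, Real.dist_eq, abs_lt]
    at h1 h2 ⊢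
  constructor <;> linarith

end MeasureTheory

/-! ### Averages over finite sets of translates -/

namespace MeasureTheory

section ShiftAverage

variable {G Ω ι : Type*}

/-- The average of `f` over the finitely many translates `τ v x`, `v ∈ S`, of `x`. -/
noncomputable def shiftAverage (τ : G → Ω → Ω) (S : Finset G) (f : Ω → ℝ) (x : Ω) : ℝ :=
  (S.card : ℝ)⁻¹ * ∑ v ∈ S, f (τ v x)

theorem abs_shiftAverage_le_of_forall (τ : G → Ω → Ω) (S : Finset G) {f g : Ω → ℝ}
    (h : ∀ x, |f x| ≤ g x) (x : Ω) : |shiftAverage τ S f x| ≤ shiftAverage τ S g x := by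
  rw [shiftAverage, abs_mul, abs_of_nonneg (by positivity)]
  exact mul_le_mul_of_nonneg_left
    ((Finset.abs_sum_le_sum_abs _ _).trans (Finset.sum_le_sum fun v _ => h _)) (by positivity)

theorem shiftAverage_const_le (τ : G → Ω → Ω) (S : Finset G) {C : ℝ} (hC : 0 ≤ C) (x : Ω) :
    shiftAverage τ S (fun _ => C) x ≤ C := by
  rw [shiftAverage, Finset.sum_const, nsmul_eq_mul, ← mul_assoc]
  exact mul_le_of_le_one_left hC inv_mul_le_one

theorem abs_shiftAverage_le (τ : G → Ω → Ω) (S : Finset G) {f : Ω → ℝ} {C : ℝ}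
    (h : ∀ x, |f x| ≤ C) (x : Ω) : |shiftAverage τ S f x| ≤ C :=
  (abs_shiftAverage_le_of_forall τ S h x).trans
    (shiftAverage_const_le τ S ((abs_nonneg _).trans (h x)) x)

theorem shiftAverage_sub (τ : G → Ω → Ω) (S : Finset G) (f g : Ω → ℝ) (x : Ω) :
    shiftAverage τ S (fun y => f y - g y) x = shiftAverage τ S f x - shiftAverage τ S g x := by
  simp only [shiftAverage, Finset.sum_sub_distrib, mul_sub]

variable [MeasurableSpace Ω] {μ : Measure Ω}

theorem measurable_shiftAverage {τ : G → Ω → Ω} (hτ : ∀ v, Measurable (τ v)) (S : Finset G)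
    {f : Ω → ℝ} (hf : Measurable f) : Measurable (shiftAverage τ S f) :=
  (Finset.measurable_sum _ fun v _ => hf.comp (hτ v)).const_mul _

theorem integrable_of_abs_le [IsFiniteMeasure μ] {f : Ω → ℝ} (hf : Measurable f) {C : ℝ}
    (h : ∀ x, |f x| ≤ C) : Integrable f μ :=
  .of_bound hf.aestronglyMeasurable C (Eventually.of_forall h)

theorem integral_shiftAverage [IsFiniteMeasure μ] {τ : G → Ω → Ω}
    (hτ : ∀ v, MeasurePreserving (τ v) μ μ) {S : Finset G} (hS : S.Nonempty) {f : Ω → ℝ}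
    (hfm : Measurable f) {C : ℝ} (hf : ∀ x, |f x| ≤ C) :
    ∫ x, shiftAverage τ S f x ∂μ = ∫ x, f x ∂μ := by
  have hv : ∀ v, ∫ x, f (τ v x) ∂μ = ∫ x, f x ∂μ := fun v => by
    rw [← integral_map (hτ v).measurable.aemeasurable hfm.aestronglyMeasurable, (hτ v).map_eq]
  simp only [shiftAverage]
  rw [integral_const_mul, integral_finsetSum _ fun v _ => integrable_of_abs_le
    (f := fun x => f (τ v x)) (hfm.comp (hτ v).measurable) fun x => hf _]
  simp only [hv, Finset.sum_const, nsmul_eq_mul]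
  rw [inv_mul_cancel_left₀ (by exact_mod_cast hS.card_ne_zero)]

/-- A family of bounded measurable functions that converges almost everywhere has a bounded
measurable limit. -/
theorem exists_measurable_bounded_limit {l : Filter ι} [l.IsCountablyGenerated] [l.NeBot]
    [Countable ι]
    {u : ι → Ω → ℝ} (hum : ∀ p, Measurable (u p)) {C : ℝ} (hu : ∀ p x, |u p x| ≤ C)
    (hlim : ∀ᵐ x ∂μ, ∃ c, Tendsto (fun p => u p x) l (𝓝 c)) :
    ∃ F : Ω → ℝ, Measurable F ∧ (∀ x, |F x| ≤ |C|) ∧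
      ∀ᵐ x ∂μ, Tendsto (fun p => u p x) l (𝓝 (F x)) := by
  have hm : Measurable fun x => limUnder l fun p => u p x :=
    (StronglyMeasurable.limUnder (l := l) fun p => (hum p).stronglyMeasurable).measurable
  -- Truncation gives a bound everywhere, including where `limUnder` is a junk value. The absolute
  -- value avoids having to know that `C` is nonnegative.
  refine ⟨fun x => max (-|C|) (min |C| (limUnder l fun p => u p x)),
    measurable_const.max (measurable_const.min hm), fun x => ?_, ?_⟩
  · have := abs_nonneg C
    exact abs_le.2 ⟨le_max_left _ _, max_le (by linarith) (min_le_left _ _)⟩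
  · filter_upwards [hlim] with x hx
    have h := tendsto_nhds_limUnder hx
    have habs : |limUnder l fun p => u p x| ≤ |C| :=
      le_of_tendsto h.abs (Eventually.of_forall fun p => (hu p x).trans (le_abs_self C))
    rw [min_eq_right (abs_le.1 habs).2, max_eq_right (abs_le.1 habs).1]
    exact h

/-- The averages over the translates by `S p` of every bounded measurable function converge almost
everywhere. -/
def AveragesConverge (μ : Measure Ω) (τ : G → Ω → Ω) (l : Filter ι) (S : ι → Finset G) : Prop :=
  ∀ f : Ω → ℝ, Measurable f → ∀ C, (∀ x, |f x| ≤ C) →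
    ∀ᵐ x ∂μ, ∃ c, Tendsto (fun p => shiftAverage τ (S p) f x) l (𝓝 c)

/-- The pointwise infimum has integral zero, hence vanishes almost everywhere; no subsequence is
needed. -/
theorem ae_exists_lt_of_tendsto_integral {h : ℕ → Ω → ℝ} (hi : ∀ n, Integrable (h n) μ)
    (h0 : ∀ n, 0 ≤ᵐ[μ] h n) (ht : Tendsto (fun n => ∫ x, h n x ∂μ) atTop (𝓝 0)) :
    ∀ᵐ x ∂μ, ∀ ε > 0, ∃ n, h n x < ε := by
  have hz : ∫⁻ x, ⨅ n, ENNReal.ofReal (h n x) ∂μ = 0 := by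
    refine le_antisymm (ge_of_tendsto' (x := atTop) (f := fun n => ENNReal.ofReal (∫ x, h n x ∂μ))
      (by simpa using ENNReal.tendsto_ofReal ht) fun n => ?_) zero_le
    rw [ofReal_integral_eq_lintegral_ofReal (hi n) (h0 n)]
    exact lintegral_mono fun x => iInf_le _ n
  have hm : AEMeasurable (fun x => ⨅ n, ENNReal.ofReal (h n x)) μ :=
    AEMeasurable.iInf fun n => (hi n).1.aemeasurable.ennreal_ofReal
  filter_upwards [(lintegral_eq_zero_iff' hm).1 hz] with x hx ε hε
  have : ⨅ n, ENNReal.ofReal (h n x) < ENNReal.ofReal ε := by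
    rw [show (⨅ n, ENNReal.ofReal (h n x)) = 0 from hx]
    simpa using hε
  obtain ⟨n, hn⟩ := iInf_lt_iff.1 this
  exact ⟨n, (ENNReal.ofReal_lt_ofReal_iff hε).1 hn⟩

variable [IsFiniteMeasure μ] {l : Filter ι} [l.IsCountablyGenerated] [l.NeBot] [Countable ι]

/-- If a bounded family `u` converges almost everywhere, then so do the averages of the
simultaneously varying functions `u p`. -/
theorem AveragesConverge.comp {τ : G → Ω → Ω} (hτ : ∀ v, MeasurePreserving (τ v) μ μ)
    {S : ι → Finset G} (hS : ∀ᶠ p in l, (S p).Nonempty) (hA : AveragesConverge μ τ l S)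
    {u : ι → Ω → ℝ} (hum : ∀ p, Measurable (u p)) {C : ℝ} (hu : ∀ p x, |u p x| ≤ C)
    (hlim : ∀ᵐ x ∂μ, ∃ c, Tendsto (fun p => u p x) l (𝓝 c)) :
    ∀ᵐ x ∂μ, ∃ c, Tendsto (fun p => shiftAverage τ (S p) (u p) x) l (𝓝 c) := by
  obtain ⟨F, hFm, hF, hFlim⟩ := exists_measurable_bounded_limit hum hu hlim
  obtain ⟨U, hU⟩ := l.exists_antitone_basis
  have hUne : ∀ n, Nonempty (U n) := fun n => ((hU.1.neBot_iff.1 ‹_›) trivial).to_subtype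
  -- Once `p` lies in `U n`, the function `g n` dominates the error `|u p - F|` uniformly in `p`.
  -- The average of the varying error is thereby controlled by averages of one fixed function.
  set g : ℕ → Ω → ℝ := fun n x => ⨆ q : U n, |u q x - F x| with hg
  have hb : ∀ q x, |u q x - F x| ≤ C + |C| := fun q x =>
    (abs_sub _ _).trans (add_le_add (hu q x) (hF x))
  have hbdd : ∀ n x, BddAbove (Set.range fun q : U n => |u q x - F x|) := fun n x =>
    ⟨C + |C|, by rintro _ ⟨q, rfl⟩; exact hb q x⟩
  have hgm : ∀ n, Measurable (g n) := fun n =>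
    Measurable.iSup fun q : U n => ((hum q).sub hFm).abs
  have hle : ∀ n, ∀ q ∈ U n, ∀ x, |u q x - F x| ≤ g n x := fun n q hq x =>
    le_ciSup (hbdd n x) ⟨q, hq⟩
  have hg0 : ∀ n x, 0 ≤ g n x := fun n x => Real.iSup_nonneg fun _ => abs_nonneg _
  have hgb : ∀ n x, |g n x| ≤ C + |C| := fun n x => by
    rw [abs_of_nonneg (hg0 n x)]
    exact ciSup_le fun q => hb q x
  have hgt : ∀ᵐ x ∂μ, Tendsto (fun n => g n x) atTop (𝓝 0) := by
    filter_upwards [hFlim] with x hx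
    rw [Metric.tendsto_atTop]
    intro ε hε
    obtain ⟨N, -, hN⟩ := hU.1.mem_iff.1 (Metric.tendsto_nhds.1 hx (ε / 2) (half_pos hε))
    refine ⟨N, fun n hn => ?_⟩
    rw [Real.dist_eq, sub_zero, abs_of_nonneg (hg0 n x)]
    refine lt_of_le_of_lt (ciSup_le fun q => ?_) (half_lt_self hε)
    exact (hN (hU.2 hn q.2)).le
  have hgi : Tendsto (fun n => ∫ x, g n x ∂μ) atTop (𝓝 0) := by
    simpa using tendsto_integral_of_dominated_convergence (fun _ => C + |C|)
      (fun n => (hgm n).aestronglyMeasurable) (integrable_const _)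
      (fun n => Eventually.of_forall (hgb n)) hgt
  have hτm : ∀ v, Measurable (τ v) := fun v => (hτ v).measurable
  choose h hhm hh hhlim using fun n => exists_measurable_bounded_limit (l := l)
    (fun p => measurable_shiftAverage hτm (S p) (hgm n))
    (fun p x => abs_shiftAverage_le τ (S p) (hgb n) x) (hA (g n) (hgm n) _ (hgb n))
  -- Averaging preserves integrals, and so does the bounded limit. This suffices to make the limits
  -- `h n` small without identifying them.
  have hhi : ∀ n, ∫ x, h n x ∂μ = ∫ x, g n x ∂μ := fun n => by
    refine tendsto_nhds_unique (tendsto_integral_filter_of_dominated_convergence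
      (fun _ => C + |C|)
      (Eventually.of_forall fun p =>
        (measurable_shiftAverage hτm (S p) (hgm n)).aestronglyMeasurable)
      (Eventually.of_forall fun p =>
        Eventually.of_forall fun x => abs_shiftAverage_le τ (S p) (hgb n) x)
      (integrable_const _) (hhlim n)) ?_
    refine tendsto_const_nhds.congr' ?_
    filter_upwards [hS] with p hp
    exact (integral_shiftAverage hτ hp (hgm n) (hgb n)).symm
  have hsmall := ae_exists_lt_of_tendsto_integral
    (fun n => integrable_of_abs_le (μ := μ) (hhm n) (hh n))
    (fun n => by
      filter_upwards [hhlim n] with x hx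
      refine ge_of_tendsto' hx fun p => ?_
      exact mul_nonneg (by positivity) (Finset.sum_nonneg fun _ _ => hg0 n _))
    (by simpa only [hhi] using hgi)
  filter_upwards [hA F hFm _ hF, ae_all_iff.2 hhlim, hsmall] with x ⟨c, hc⟩ hx hsx
  refine ⟨c, ?_⟩
  have hdiff : Tendsto (fun p => shiftAverage τ (S p) (u p) x - shiftAverage τ (S p) F x)
      l (𝓝 0) := by
    rw [Metric.tendsto_nhds]
    intro ε hε
    obtain ⟨n, hn⟩ := hsx ε hε
    filter_upwards [(hx n).eventually_lt_const hn, hU.1.mem_of_mem (i := n) trivial] with p hp hpU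
    rw [Real.dist_eq, sub_zero, ← shiftAverage_sub]
    exact (abs_shiftAverage_le_of_forall τ (S p) (hle n p hpU) x).trans_lt hp
  simpa using hdiff.add hc

end ShiftAverage

/-! ### Averages over two-sided intervals -/

section Interval

theorem sum_Ico_neg_natCast (f : ℤ → ℝ) (m n : ℕ) :
    ∑ j ∈ Finset.Ico (-n : ℤ) m, f j =
      ∑ k ∈ Finset.range m, f k + ∑ k ∈ Finset.range n, f (-1 - k) := by
  have h1 : ∑ k ∈ Finset.range m, f k = ∑ j ∈ Finset.Ico (0 : ℤ) m, f j :=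
    Finset.sum_nbij (fun k => (k : ℤ)) (by simp) (by simp [Set.InjOn])
      (fun j hj => ⟨j.toNat, by simp at hj ⊢; omega⟩) (by simp)
  have h2 : ∑ k ∈ Finset.range n, f (-1 - k) = ∑ j ∈ Finset.Ico (-n : ℤ) 0, f j :=
    Finset.sum_nbij (fun k => -1 - (k : ℤ)) (by simp; omega) (by intro; simp)
      (fun j hj => ⟨(-1 - j).toNat, by simp at hj ⊢; omega⟩) (by simp)
  rw [h1, h2, ← Finset.Ico_union_Ico_eq_Ico (b := 0) (by simp) (by simp),
    Finset.sum_union (Finset.Ico_disjoint_Ico_consecutive _ _ _), add_comm]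

variable {Ω ι : Type*} {τ : ℤ → Ω → Ω}

theorem iterate_eq_of_add (h0 : ∀ x, τ 0 x = x) (hadd : ∀ i j x, τ (i + j) x = τ i (τ j x))
    (i : ℤ) (n : ℕ) (x : Ω) : (τ i)^[n] x = τ (n * i) x := by
  induction n with
  | zero => simp [h0]
  | succ n ih =>
    rw [Function.iterate_succ_apply', ih, ← hadd]
    congr 1
    push_cast
    ring

theorem sum_Icc_eq_birkhoffSum (h0 : ∀ x, τ 0 x = x)
    (hadd : ∀ i j x, τ (i + j) x = τ i (τ j x)) (f : Ω → ℝ) {a b : ℤ} (ha : a ≤ 0) (hb : 0 ≤ b)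
    (x : Ω) :
    ∑ j ∈ Finset.Icc a b, f (τ j x) =
      birkhoffSum (τ 1) f (b + 1).toNat x +
        birkhoffSum (τ (-1)) f (-a).toNat (τ (-1) x) := by
  have hI : Finset.Icc a b = Finset.Ico (-((-a).toNat : ℤ)) ((b + 1).toNat : ℤ) := by
    ext j; simp; omega
  rw [hI, sum_Ico_neg_natCast (fun j => f (τ j x))]
  simp only [birkhoffSum, iterate_eq_of_add h0 hadd, ← hadd]
  congr 1
  · simp
  · refine Finset.sum_congr rfl fun k _ => ?_
    congr 2
    ring

variable [MeasurableSpace Ω] {μ : Measure Ω} [IsFiniteMeasure μ]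

theorem invariants_neg (h0 : ∀ x, τ 0 x = x) (hadd : ∀ i j x, τ (i + j) x = τ i (τ j x))
    (i : ℤ) : MeasurableSpace.invariants (τ i) ≤ MeasurableSpace.invariants (τ (-i)) := by
  rintro s ⟨hs, hsi⟩
  refine ⟨hs, ?_⟩
  conv_lhs => rw [← hsi]
  ext x
  simp [← hadd, h0]

/-- The pointwise ergodic theorem for averages over two-sided intervals. -/
theorem averagesConverge_Icc (h0 : ∀ x, τ 0 x = x) (hadd : ∀ i j x, τ (i + j) x = τ i (τ j x))
    (hτ : ∀ j, MeasurePreserving (τ j) μ μ) {l : Filter ι} {a b : ι → ℤ}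
    (ha : Tendsto a l atBot) (hb : Tendsto b l atTop) :
    AveragesConverge μ τ l fun p => Finset.Icc (a p) (b p) := by
  intro f hfm C hf
  have hfi : Integrable f μ := integrable_of_abs_le hfm hf
  -- The forward and backward halves of the interval have the same limit because a map and its
  -- inverse have the same invariant sets.
  have hinv : MeasurableSpace.invariants (τ (-1)) = MeasurableSpace.invariants (τ 1) :=
    le_antisymm (by simpa using invariants_neg h0 hadd (-1)) (invariants_neg h0 hadd 1)
  filter_upwards [ae_tendsto_birkhoffAverage (hτ 1) hfm hfi,
    ae_tendsto_birkhoffAverage (hτ (-1)) hfm hfi] with x h1 h2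
  rw [hinv] at h2
  set c := (μ[f|MeasurableSpace.invariants (τ 1)]) x
  -- The backward half starts at `-1`, not `0`; for bounded `f` moving the starting point along the
  -- orbit does not change the limit.
  have h3 : Tendsto (fun n => birkhoffAverage ℝ (τ (-1)) f n (τ (-1) x)) atTop (𝓝 c) := by
    have := (tendsto_birkhoffAverage_apply_sub_birkhoffAverage ℝ (f := τ (-1)) (g := f) (x := x)
      ((Metric.isBounded_closedBall (x := (0 : ℝ)) (r := C)).subset (by
        rintro _ ⟨n, rfl⟩
        simpa using hf _))).add h2
    simpa using this
  have hm : Tendsto (fun p => (b p + 1).toNat) l atTop := by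
    refine tendsto_atTop.2 fun N => ?_
    filter_upwards [hb.eventually_ge_atTop N] with p hp
    omega
  have hn : Tendsto (fun p => (-a p).toNat) l atTop := by
    refine tendsto_atTop.2 fun N => ?_
    filter_upwards [ha.eventually_le_atBot (-N)] with p hp
    omega
  refine ⟨c, Metric.tendsto_nhds.2 fun ε hε => ?_⟩
  filter_upwards [Metric.tendsto_nhds.1 (h1.comp hm) ε hε, Metric.tendsto_nhds.1 (h3.comp hn) ε hε,
    hm.eventually_ge_atTop 1, hn.eventually_ge_atTop 1] with p h1 h3 hm1 hn1
  have hcard : (Finset.Icc (a p) (b p)).card = (b p + 1).toNat + (-a p).toNat := by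
    rw [Int.card_Icc]; omega
  rw [shiftAverage, sum_Icc_eq_birkhoffSum h0 hadd f (by omega) (by omega), hcard]
  simp only [Function.comp_apply, birkhoffAverage, smul_eq_mul, Real.dist_eq] at h1 h3 ⊢
  generalize birkhoffSum (τ 1) f (b p + 1).toNat x = s at *
  generalize birkhoffSum (τ (-1)) f (-a p).toNat (τ (-1) x) = t at *
  generalize (b p + 1).toNat = m at *
  generalize (-a p).toNat = n at *
  have hm0 : (0 : ℝ) < m := by exact_mod_cast hm1
  have hn0 : (0 : ℝ) < n := by exact_mod_cast hn1
  -- The two-sided average is a convex combination of the one-sided ones, so nothing is assumed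
  -- about the ratio of `m` and `n`.
  have key : ((m + n : ℕ) : ℝ)⁻¹ * (s + t) - c =
      (m * ((m : ℝ)⁻¹ * s - c) + n * ((n : ℝ)⁻¹ * t - c)) / (m + n) := by
    push_cast
    field_simp
    ring
  rw [key, abs_div, abs_of_pos (add_pos hm0 hn0), div_lt_iff₀ (add_pos hm0 hn0)]
  calc _ ≤ |m * ((m : ℝ)⁻¹ * s - c)| + |n * ((n : ℝ)⁻¹ * t - c)| := abs_add_le _ _
    _ = m * |(m : ℝ)⁻¹ * s - c| + n * |(n : ℝ)⁻¹ * t - c| := by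
      rw [abs_mul, abs_mul, abs_of_pos hm0, abs_of_pos hn0]
    _ < ε * (m + n) := by nlinarith

end Interval

/-! ### Averages over boxes -/

section Box

variable {κ : Type*} [Fintype κ] [DecidableEq κ]

/-- The box with sides `[a i, b i]` in the directions `i ∈ s` and trivial sides otherwise. -/
noncomputable def partialBox (s : Finset κ) (a b : κ → ℤ) : Finset (κ → ℤ) :=
  Fintype.piFinset fun i => if i ∈ s then Finset.Icc (a i) (b i) else {0}

theorem mem_partialBox {s : Finset κ} {a b v : κ → ℤ} :
    v ∈ partialBox s a b ↔ ∀ i, if i ∈ s then a i ≤ v i ∧ v i ≤ b i else v i = 0 := by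
  simp only [partialBox, Fintype.mem_piFinset]
  refine forall_congr' fun i => ?_
  split_ifs <;> simp

theorem partialBox_univ (a b : κ → ℤ) : partialBox Finset.univ a b = Finset.Icc a b := by
  ext v
  simp [mem_partialBox, Pi.le_def, forall_and]

theorem sum_partialBox_insert {s : Finset κ} {i : κ} (hi : i ∉ s) (a b : κ → ℤ)
    (g : (κ → ℤ) → ℝ) :
    ∑ v ∈ partialBox (insert i s) a b, g v =
      ∑ j ∈ Finset.Icc (a i) (b i), ∑ v ∈ partialBox s a b, g (v + Pi.single i j) := by
  rw [← Finset.sum_product']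
  refine Finset.sum_bij' (fun v _ => (v i, Function.update v i 0))
    (fun q _ => q.2 + Pi.single i q.1) ?_ ?_ ?_ ?_ ?_
  · intro v hv
    rw [mem_partialBox] at hv
    have hvi := hv i
    simp only [Finset.mem_insert_self, if_true] at hvi
    refine Finset.mem_product.2 ⟨Finset.mem_Icc.2 hvi, mem_partialBox.2 fun k => ?_⟩
    have hk := hv k
    by_cases hki : k = i
    · subst hki; simp [hi]
    · simpa [hki] using hk
  · rintro ⟨j, v⟩ hq
    obtain ⟨hj, hv⟩ := Finset.mem_product.1 hq
    rw [mem_partialBox] at hv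
    refine mem_partialBox.2 fun k => ?_
    have hk := hv k
    by_cases hki : k = i
    · subst hki
      simp only [hi, if_false] at hk
      simpa [hk] using hj
    · simpa [hki] using hk
  · intro v _
    funext k
    by_cases hki : k = i
    · subst hki; simp
    · simp [hki]
  · rintro ⟨j, v⟩ hq
    have hv := mem_partialBox.1 (Finset.mem_product.1 hq).2 i
    simp only [hi, if_false] at hv
    refine Prod.ext (by simp [hv]) (funext fun k => ?_)
    by_cases hki : k = i
    · subst hki; simp [hv]
    · simp [hki]
  · intro v _
    congr 1
    funext k
    by_cases hki : k = i
    · subst hki; simp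
    · simp [hki]

variable {Ω ι : Type*} {τ : (κ → ℤ) → Ω → Ω}

theorem shiftAverage_partialBox_insert (hadd : ∀ v w x, τ (v + w) x = τ v (τ w x)) {s : Finset κ}
    {i : κ} (hi : i ∉ s) (a b : κ → ℤ) (f : Ω → ℝ) (x : Ω) :
    shiftAverage τ (partialBox (insert i s) a b) f x =
      shiftAverage (fun j => τ (Pi.single i j)) (Finset.Icc (a i) (b i))
        (shiftAverage τ (partialBox s a b) f) x := by
  have hcard : ((partialBox (insert i s) a b).card : ℝ) =
      (Finset.Icc (a i) (b i)).card * (partialBox s a b).card := by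
    simpa using sum_partialBox_insert hi a b fun _ => 1
  simp only [shiftAverage, hcard, sum_partialBox_insert hi, hadd, mul_inv, Finset.mul_sum,
    mul_assoc]

variable [MeasurableSpace Ω] {μ : Measure Ω} [IsFiniteMeasure μ]

/-- The multiparameter pointwise ergodic theorem for bounded functions, for averages over boxes of
which the sides grow independently of each other. -/
theorem averagesConverge_box (h0 : ∀ x, τ 0 x = x) (hadd : ∀ v w x, τ (v + w) x = τ v (τ w x))
    (hτ : ∀ v, MeasurePreserving (τ v) μ μ) {l : Filter ι} [l.IsCountablyGenerated] [l.NeBot]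
    [Countable ι] {a b : ι → κ → ℤ} (ha : ∀ i, Tendsto (fun p => a p i) l atBot)
    (hb : ∀ i, Tendsto (fun p => b p i) l atTop) :
    AveragesConverge μ τ l fun p => Finset.Icc (a p) (b p) := by
  intro f hfm C hf
  suffices h : ∀ s : Finset κ, ∀ᵐ x ∂μ,
      ∃ c, Tendsto (fun p => shiftAverage τ (partialBox s (a p) (b p)) f x) l (𝓝 c) by
    simpa only [partialBox_univ] using h Finset.univ
  intro s
  induction s using Finset.induction_on with
  | empty =>
    refine Eventually.of_forall fun x => ⟨shiftAverage τ (partialBox ∅ 0 0) f x, ?_⟩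
    simp [partialBox]
  | insert i s hi ih =>
    -- A new direction is added as an outer interval average. The inner average depends on the same
    -- `p`, which is why `AveragesConverge.comp` is needed instead of an iterated limit.
    simp only [shiftAverage_partialBox_insert hadd hi]
    refine AveragesConverge.comp (fun j => hτ _) ?_ (averagesConverge_Icc (by simpa using h0)
      (fun j k x => by rw [Pi.single_add, hadd]) (fun j => hτ _) (ha i) (hb i))
      (fun p => measurable_shiftAverage (fun v => (hτ v).measurable) _ hfm)
      (fun p x => abs_shiftAverage_le τ _ hf x) ih
    filter_upwards [(ha i).eventually_le_atBot 0, (hb i).eventually_ge_atTop 0] with p hp hq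
    exact Finset.nonempty_Icc.2 (hp.trans hq)

end Box

end MeasureTheory

/-! ### Translation invariance of the law of two replicas -/

namespace EA

variable {d : ℕ}

theorem update_mem_Icc {a b x : Site d} (hx : x ∈ Finset.Icc a b) {i : Fin d} {c : ℤ}
    (hc : a i ≤ c ∧ c ≤ b i) : Function.update x i c ∈ Finset.Icc a b := by
  rw [Finset.mem_Icc] at hx ⊢
  exact ⟨le_update_iff.2 ⟨hc.1, fun j _ => hx.1 j⟩, update_le_iff.2 ⟨hc.2, fun j _ => hx.2 j⟩⟩

theorem torusNext_mem_Icc {a b x : Site d} (hx : x ∈ Finset.Icc a b) (i : Fin d) :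
    torusNext a b x i ∈ Finset.Icc a b := by
  refine update_mem_Icc hx ?_
  have h1 : a i ≤ x i := (Finset.mem_Icc.1 hx).1 i
  have h2 : x i ≤ b i := (Finset.mem_Icc.1 hx).2 i
  split_ifs <;> omega

/-- The translation by one step in direction `i` of the box `[a, b]` with opposite faces
identified, extended by the identity outside the box. -/
noncomputable def torusShift (a b : Site d) (i : Fin d) : Equiv.Perm (Site d) where
  toFun x := if x ∈ Finset.Icc a b then torusNext a b x i else x
  invFun x :=
    if x ∈ Finset.Icc a b then Function.update x i (if x i = a i then b i else x i - 1) else x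
  left_inv x := by
    by_cases hx : x ∈ Finset.Icc a b
    · have h1 : a i ≤ x i := (Finset.mem_Icc.1 hx).1 i
      simp only [if_pos hx, if_pos (torusNext_mem_Icc hx i)]
      simp only [torusNext, Function.update_self, Function.update_idem]
      conv_rhs => rw [← Function.update_eq_self i x]
      congr 1
      split_ifs <;> omega
    · simp only [if_neg hx]
  right_inv x := by
    by_cases hx : x ∈ Finset.Icc a b
    · have h1 : a i ≤ x i := (Finset.mem_Icc.1 hx).1 i
      have h2 : x i ≤ b i := (Finset.mem_Icc.1 hx).2 i
      have hm : Function.update x i (if x i = a i then b i else x i - 1) ∈ Finset.Icc a b :=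
        update_mem_Icc hx (by split_ifs <;> omega)
      simp only [if_pos hx, if_pos hm]
      simp only [torusNext, Function.update_self, Function.update_idem]
      conv_rhs => rw [← Function.update_eq_self i x]
      congr 1
      split_ifs <;> omega
    · simp only [if_neg hx]

theorem torusShift_apply {a b x : Site d} (hx : x ∈ Finset.Icc a b) (i : Fin d) :
    torusShift a b i x = torusNext a b x i := if_pos hx

theorem torusShift_apply_of_notMem {a b x : Site d} (hx : x ∉ Finset.Icc a b) (i : Fin d) :
    torusShift a b i x = x := if_neg hx

theorem torusShift_mem_Icc_iff {a b x : Site d} (i : Fin d) :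
    torusShift a b i x ∈ Finset.Icc a b ↔ x ∈ Finset.Icc a b := by
  by_cases hx : x ∈ Finset.Icc a b
  · simp only [torusShift_apply hx, torusNext_mem_Icc hx, hx]
  · rw [torusShift_apply_of_notMem hx]

theorem torusShift_torusNext {a b x : Site d} (hx : x ∈ Finset.Icc a b) (i j : Fin d) :
    torusShift a b i (torusNext a b x j) = torusNext a b (torusShift a b i x) j := by
  rw [torusShift_apply hx, torusShift_apply (torusNext_mem_Icc hx j)]
  funext k
  by_cases hij : i = j
  · subst hij; rfl
  · by_cases hki : k = i
    · subst hki; simp [torusNext, hij]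
    · by_cases hkj : k = j
      · subst hkj; simp [torusNext, hki]
      · simp [torusNext, hki, hkj]

/-- The permutation of the edges induced by `torusShift`. -/
noncomputable def torusEdgeShift (a b : Site d) (i : Fin d) : Equiv.Perm (Edge d) :=
  (torusShift a b i).prodCongr (Equiv.refl _)

/-- The rotation permutes the edges of the torus, a wrapping edge taking its coupling from the site
at which it is based; the sum is merely reindexed. -/
theorem hamiltonian_torusShift (a b : Site d) (i : Fin d) (J : Coupling d) (σ : Config d) :
    hamiltonian a b (J ∘ torusEdgeShift a b i) (σ ∘ torusShift a b i) = hamiltonian a b J σ := by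
  unfold hamiltonian
  congr 1
  refine Finset.sum_equiv (torusShift a b i) (fun x => (torusShift_mem_Icc_iff i).symm)
    fun x hx => Finset.sum_congr rfl fun j _ => ?_
  simp only [Function.comp_apply, torusShift_torusNext hx i j]
  rfl

/-- The action of `torusShift` on the configurations in the box. -/
noncomputable def torusConfigShift (a b : Site d) (i : Fin d) :
    Equiv.Perm (Finset.Icc a b → Bool) :=
  ((torusShift a b i).subtypePerm fun _ => torusShift_mem_Icc_iff i).symm.arrowCongr (Equiv.refl _)

theorem extend_torusConfigShift (a b : Site d) (i : Fin d) (τ : Finset.Icc a b → Bool) :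
    extend (Finset.Icc a b) (torusConfigShift a b i τ) =
      extend (Finset.Icc a b) τ ∘ torusShift a b i := by
  funext x
  by_cases hx : x ∈ Finset.Icc a b
  · simp only [extend, Function.comp_apply, dif_pos hx, dif_pos ((torusShift_mem_Icc_iff i).2 hx)]
    rfl
  · simp only [extend, Function.comp_apply, dif_neg hx,
      dif_neg (mt (torusShift_mem_Icc_iff i).1 hx)]

theorem hamiltonian_torusConfigShift (a b : Site d) (i : Fin d) (J : Coupling d)
    (τ : Finset.Icc a b → Bool) :
    hamiltonian a b (J ∘ torusEdgeShift a b i)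
      (extend (Finset.Icc a b) (torusConfigShift a b i τ)) =
      hamiltonian a b J (extend (Finset.Icc a b) τ) := by
  rw [extend_torusConfigShift, hamiltonian_torusShift]

theorem partitionFunction_torusShift (β : ℝ) (a b : Site d) (i : Fin d) (J : Coupling d) :
    partitionFunction β a b (J ∘ torusEdgeShift a b i) = partitionFunction β a b J := by
  unfold partitionFunction
  refine (Fintype.sum_equiv (torusConfigShift a b i) _ _ fun τ => ?_).symm
  rw [hamiltonian_torusConfigShift]

theorem gibbsMeasure_map_torusShift (β : ℝ) (a b : Site d) (i : Fin d) (J : Coupling d) :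
    (gibbsMeasure β a b J).map (fun σ => σ ∘ torusShift a b i) =
      gibbsMeasure β a b (J ∘ torusEdgeShift a b i) := by
  have hm : Measurable fun σ : Config d => σ ∘ torusShift a b i :=
    measurable_pi_lambda _ fun x => measurable_pi_apply _
  unfold gibbsMeasure
  rw [← Measure.mapₗ_apply_of_measurable hm, map_sum]
  refine Fintype.sum_equiv (torusConfigShift a b i) _ _ fun τ => ?_
  rw [map_smul, Measure.mapₗ_apply_of_measurable hm, Measure.map_dirac' hm,
    partitionFunction_torusShift, hamiltonian_torusConfigShift, extend_torusConfigShift]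

theorem measurePreserving_couplingLaw (ρ : ProbabilityMeasure ℝ) (e : Equiv.Perm (Edge d)) :
    MeasurePreserving (fun J : Coupling d => J ∘ e) (couplingLaw d ρ : Measure (Coupling d))
      (couplingLaw d ρ) :=
  ⟨measurable_pi_lambda _ fun _ => measurable_pi_apply _,
    Measure.map_infinitePi_infinitePi_of_inj (P := fun _ : Edge d => (ρ : Measure ℝ)) e.injective⟩

theorem replicas_map_pair (Γ : ProbabilityMeasure (Config d)) {i j : ℕ} (hij : i ≠ j) :
    (replicas d Γ).map (fun σ => (σ i, σ j)) =
      (Γ : Measure (Config d)).prod (Γ : Measure (Config d)) :=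
  Measure.infinitePi_map_eval_prod (P := fun _ : ℕ => (Γ : Measure (Config d))) hij

/-- The first two replicas. -/
def firstPair (q : Coupling d × (ℕ → Config d)) : Config d × Config d := (q.2 0, q.2 1)

theorem measurable_firstPair : Measurable (firstPair (d := d)) := by
  unfold firstPair
  fun_prop

/-- The law of the first two replicas. -/
noncomputable def pairLaw (ν : ProbabilityMeasure (Coupling d))
    (κ : Kernel (Coupling d) (ProbabilityMeasure (Config d))) [IsMarkovKernel κ] :
    ProbabilityMeasure (Config d × Config d) :=
  (jointLaw ν κ).map measurable_firstPair.aemeasurable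

theorem pairLaw_deterministic_apply (ν : ProbabilityMeasure (Coupling d))
    {G : Coupling d → ProbabilityMeasure (Config d)} (hG : Measurable G)
    {A : Set (Config d × Config d)} (hA : MeasurableSet A) :
    (pairLaw ν (Kernel.deterministic G hG) : Measure (Config d × Config d)) A =
      ∫⁻ J, ((G J : Measure (Config d)).prod (G J : Measure (Config d))) A
        ∂(ν : Measure (Coupling d)) := by
  have hm : Measurable fun σ : ℕ → Config d => (σ 0, σ 1) := by fun_prop
  rw [pairLaw, ProbabilityMeasure.toMeasure_map, Measure.map_apply measurable_firstPair hA]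
  change ((ν : Measure (Coupling d)) ⊗ₘ replicaKernel (Kernel.deterministic G hG)) _ = _
  rw [Measure.compProd_apply (measurable_firstPair hA)]
  refine lintegral_congr fun J => ?_
  rw [replicaKernel, Kernel.comp_deterministic_eq_comap, Kernel.comap_apply,
    ← replicas_map_pair (G J) zero_ne_one, Measure.map_apply hm hA]
  rfl

theorem measurable_prod_self_apply {G : Coupling d → ProbabilityMeasure (Config d)}
    (hG : Measurable G) {A : Set (Config d × Config d)} (hA : MeasurableSet A) :
    Measurable fun J => ((G J : Measure (Config d)).prod (G J : Measure (Config d))) A := by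
  have hm : Measurable fun σ : ℕ → Config d => (σ 0, σ 1) := by fun_prop
  simp_rw [← replicas_map_pair _ zero_ne_one, Measure.map_apply hm hA]
  exact (Kernel.measurable_coe (replicas d) (hm hA)).comp hG

/-- The law of two replicas in a finite box is invariant under translations of the torus. -/
theorem pairLaw_gibbs_torusShift (ρ : ProbabilityMeasure ℝ) (β : ℝ) (a b : Site d) (i : Fin d)
    {A : Set (Config d × Config d)} (hA : MeasurableSet A) :
    (pairLaw (couplingLaw d ρ) (Kernel.deterministic (gibbs β a b) (measurable_gibbs β a b)) :
        Measure (Config d × Config d))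
        (Prod.map (· ∘ torusShift a b i) (· ∘ torusShift a b i) ⁻¹' A) =
      (pairLaw (couplingLaw d ρ) (Kernel.deterministic (gibbs β a b) (measurable_gibbs β a b)) :
        Measure (Config d × Config d)) A := by
  have hm : Measurable fun σ : Config d => σ ∘ torusShift a b i :=
    measurable_pi_lambda _ fun x => measurable_pi_apply _
  -- On the right side `J` is replaced by its permuted version, which has the same law; covariance
  -- of the Gibbs measure then gives equality for each `J`.
  rw [pairLaw_deterministic_apply _ _ hA, pairLaw_deterministic_apply _ _ ((hm.prodMap hm) hA),
    ← (measurePreserving_couplingLaw ρ (torusEdgeShift a b i)).lintegral_comp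
      (measurable_prod_self_apply (measurable_gibbs β a b) hA)]
  refine lintegral_congr fun J => ?_
  rw [← Measure.map_apply (hm.prodMap hm) hA, ← Measure.map_prod_map _ _ hm hm]
  have h := gibbsMeasure_map_torusShift β a b i J
  change ((gibbsMeasure β a b J).map _).prod ((gibbsMeasure β a b J).map _) A =
    ((gibbsMeasure β a b _).prod (gibbsMeasure β a b _)) A
  rw [h]

/-! #### Local events -/

/-- The event `A` depends only on the spins in `W`. -/
def DependsOnSpins (A : Set (Config d × Config d)) (W : Finset (Site d)) : Prop :=
  ∀ p q : Config d × Config d, (∀ x ∈ W, p.1 x = q.1 x ∧ p.2 x = q.2 x) → (p ∈ A ↔ q ∈ A)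

theorem DependsOnSpins.mono {A : Set (Config d × Config d)} {W W' : Finset (Site d)}
    (h : DependsOnSpins A W) (hW : W ⊆ W') : DependsOnSpins A W' :=
  fun p q hpq => h p q fun x hx => hpq x (hW hx)

/-- A local event in terms of the spins on which it depends. -/
theorem DependsOnSpins.exists_preimage_eq {A : Set (Config d × Config d)} {W : Finset (Site d)}
    (h : DependsOnSpins A W) :
    ∃ B : Set (((∅ : Finset (Edge d)) → ℝ) × (Fin 2 → W → Bool)),
      firstPair ⁻¹' A = restrict ∅ W 2 ⁻¹' B := by
  refine ⟨{y | (extend W (y.2 0), extend W (y.2 1)) ∈ A}, Set.ext fun q => h _ _ fun x hx => ?_⟩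
  simp [firstPair, restrict, extend, hx]

theorem DependsOnSpins.measurableSet {A : Set (Config d × Config d)} {W : Finset (Site d)}
    (h : DependsOnSpins A W) : MeasurableSet A := by
  have hm : Measurable fun p : Config d × Config d => (W.restrict p.1, W.restrict p.2) := by
    fun_prop
  have : A = (fun p : Config d × Config d => (W.restrict p.1, W.restrict p.2)) ⁻¹'
      {y | (extend W y.1, extend W y.2) ∈ A} :=
    Set.ext fun q => h _ _ fun x hx => by simp [extend, hx]
  rw [this]
  exact hm (Set.toFinite _).measurableSet

theorem isPiSystem_dependsOnSpins :
    IsPiSystem {A : Set (Config d × Config d) | ∃ W, DependsOnSpins A W} := by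
  classical
  rintro A ⟨W, hA⟩ B ⟨V, hB⟩ -
  exact ⟨W ∪ V, fun p q h => and_congr (hA.mono Finset.subset_union_left p q h)
    (hB.mono Finset.subset_union_right p q h)⟩

theorem generateFrom_dependsOnSpins :
    (inferInstance : MeasurableSpace (Config d × Config d)) =
      MeasurableSpace.generateFrom {A | ∃ W, DependsOnSpins A W} := by
  refine le_antisymm ?_ (MeasurableSpace.generateFrom_le fun A ⟨W, hA⟩ => hA.measurableSet)
  have hx : ∀ x : Site d, ∀ s : Set Bool,
      MeasurableSet[MeasurableSpace.generateFrom {A | ∃ W, DependsOnSpins A W}]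
        {p : Config d × Config d | p.1 x ∈ s} ∧
      MeasurableSet[MeasurableSpace.generateFrom {A | ∃ W, DependsOnSpins A W}]
        {p : Config d × Config d | p.2 x ∈ s} := fun x s =>
    ⟨MeasurableSpace.measurableSet_generateFrom ⟨{x}, fun p q h => by
      simp [(h x (Finset.mem_singleton_self x)).1]⟩,
    MeasurableSpace.measurableSet_generateFrom ⟨{x}, fun p q h => by
      simp [(h x (Finset.mem_singleton_self x)).2]⟩⟩
  refine sup_le (Measurable.comap_le ?_) (Measurable.comap_le ?_)
  · exact @measurable_pi_lambda _ _ _ (_) _ _ fun x s _ => (hx x s).1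
  · exact @measurable_pi_lambda _ _ _ (_) _ _ fun x s _ => (hx x s).2

/-- With no couplings observed, the finite-dimensional space is discrete. Every set then has empty
frontier, so weak convergence gives convergence of the probability of every local event. -/
theorem tendsto_pairLaw_apply {ν : ProbabilityMeasure (Coupling d)}
    {κ : Kernel (Coupling d) (ProbabilityMeasure (Config d))} [IsMarkovKernel κ]
    {κ' : ℕ → Kernel (Coupling d) (ProbabilityMeasure (Config d))} [∀ k, IsMarkovKernel (κ' k)]
    {W : Finset (Site d)}
    (h : Tendsto (fun k => (jointLaw ν (κ' k)).map (measurable_restrict ∅ W 2).aemeasurable) atTop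
      (𝓝 ((jointLaw ν κ).map (measurable_restrict ∅ W 2).aemeasurable)))
    {A : Set (Config d × Config d)} (hA : DependsOnSpins A W) :
    Tendsto (fun k => (pairLaw ν (κ' k) : Measure (Config d × Config d)) A) atTop
      (𝓝 ((pairLaw ν κ : Measure (Config d × Config d)) A)) := by
  obtain ⟨B, hB⟩ := hA.exists_preimage_eq
  have hd : DiscreteTopology (((∅ : Finset (Edge d)) → ℝ) × (Fin 2 → W → Bool)) := inferInstance
  have hBm : MeasurableSet B := (isOpen_discrete B).measurableSet
  have heq : ∀ (η : Kernel (Coupling d) (ProbabilityMeasure (Config d))) [IsMarkovKernel η],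
      (pairLaw ν η : Measure (Config d × Config d)) A =
        ((jointLaw ν η).map (measurable_restrict ∅ W 2).aemeasurable : Measure _) B := by
    intro η _
    rw [pairLaw, ProbabilityMeasure.toMeasure_map, ProbabilityMeasure.toMeasure_map,
      Measure.map_apply measurable_firstPair hA.measurableSet,
      Measure.map_apply (measurable_restrict ∅ W 2) hBm, hB]
  simp only [heq]
  exact ProbabilityMeasure.tendsto_measure_of_null_frontier_of_tendsto' h
    (by simp)

/-- The translation `σ ↦ σ (· + v)`, applied to two configurations. -/
def pairShift (v : Site d) (p : Config d × Config d) : Config d × Config d :=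
  (fun x => p.1 (x + v), fun x => p.2 (x + v))

theorem measurable_pairShift (v : Site d) : Measurable (pairShift v) := by
  unfold pairShift
  fun_prop

theorem pairShift_zero (p : Config d × Config d) : pairShift 0 p = p := by
  simp [pairShift]

theorem pairShift_add (v w : Site d) (p : Config d × Config d) :
    pairShift (v + w) p = pairShift v (pairShift w p) := by
  simp [pairShift, add_assoc]

theorem DependsOnSpins.preimage_pairShift {A : Set (Config d × Config d)} {W : Finset (Site d)}
    (h : DependsOnSpins A W) (v : Site d) :
    DependsOnSpins (pairShift v ⁻¹' A) (W.map (addRightEmbedding v)) :=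
  fun _ _ hpq => h _ _ fun x hx => hpq (x + v) (Finset.mem_map_of_mem _ hx)

theorem preimage_pairShift_eq_preimage_torusShift {A : Set (Config d × Config d)}
    {W : Finset (Site d)} (h : DependsOnSpins A W) {a b : Site d} {i : Fin d}
    (hW : ∀ x ∈ W, x ∈ Finset.Icc a b ∧ x i ≠ b i) :
    pairShift (Pi.single i 1) ⁻¹' A =
      Prod.map (· ∘ torusShift a b i) (· ∘ torusShift a b i) ⁻¹' A := by
  refine Set.ext fun p => h _ _ fun x hx => ?_
  obtain ⟨hx, hxi⟩ := hW x hx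
  have : torusShift a b i x = x + Pi.single i 1 := by
    rw [torusShift_apply hx, torusNext, if_neg hxi]
    funext k
    by_cases hki : k = i
    · subst hki; simp
    · simp [hki]
  simp [pairShift, this]

/-- The law of two replicas sampled from a metastate is translation invariant. -/
theorem measurePreserving_pairShift_single {ρ : ProbabilityMeasure ℝ} {β : ℝ} {a b : ℕ → Site d}
    (ha : Tendsto a atTop atBot) (hb : Tendsto b atTop atTop)
    {κ : Kernel (Coupling d) (ProbabilityMeasure (Config d))} [IsMarkovKernel κ]
    (hκ : IsMetastate (couplingLaw d ρ) β a b κ) (i : Fin d) :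
    MeasurePreserving (pairShift (Pi.single i 1))
      (pairLaw (couplingLaw d ρ) κ : Measure (Config d × Config d))
      (pairLaw (couplingLaw d ρ) κ) := by
  refine ⟨measurable_pairShift _, ?_⟩
  have hprob := Measure.isProbabilityMeasure_map
    (μ := (pairLaw (couplingLaw d ρ) κ : Measure (Config d × Config d)))
    (measurable_pairShift (Pi.single i 1)).aemeasurable
  refine ext_of_generate_finite _ generateFrom_dependsOnSpins isPiSystem_dependsOnSpins ?_
    (by rw [measure_univ, measure_univ])
  rintro A ⟨W, hA⟩
  rw [Measure.map_apply (measurable_pairShift _) hA.measurableSet]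
  obtain ⟨φ, hφ, hlim⟩ := hκ
  refine tendsto_nhds_unique
    (tendsto_pairLaw_apply (hlim ∅ _ 2) (hA.preimage_pairShift (Pi.single i 1)))
    ((tendsto_pairLaw_apply (hlim ∅ W 2) hA).congr' ?_)
  -- The margin of one site keeps `W` off the upper faces, where the rotation would wrap around.
  have hev : ∀ᶠ k in atTop, ∀ x ∈ W, a (φ k) ≤ x ∧ x + 1 ≤ b (φ k) :=
    (Finset.eventually_all W).2 fun x _ =>
      ((ha.comp hφ.tendsto_atTop).eventually_le_atBot x).and
        ((hb.comp hφ.tendsto_atTop).eventually_ge_atTop (x + 1))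
  filter_upwards [hev] with k hk
  rw [preimage_pairShift_eq_preimage_torusShift hA (a := a (φ k)) (b := b (φ k)),
    pairLaw_gibbs_torusShift _ _ _ _ _ hA.measurableSet]
  intro x hx
  obtain ⟨h1, h2⟩ := hk x hx
  have hlt : ∀ j, x j < b (φ k) j := fun j => (lt_add_one (x j)).trans_le (h2 j)
  exact ⟨Finset.mem_Icc.2 ⟨h1, fun j => (hlt j).le⟩, (hlt i).ne⟩

/-- The translations that preserve `μ` form a subgroup, and the unit vectors generate the lattice.
-/
theorem measurePreserving_pairShift {μ : Measure (Config d × Config d)}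
    (h : ∀ i : Fin d, MeasurePreserving (pairShift (Pi.single i 1)) μ μ) (v : Site d) :
    MeasurePreserving (pairShift v) μ μ := by
  let H : AddSubgroup (Site d) :=
    { carrier := {v | μ.map (pairShift v) = μ}
      zero_mem' := by
        have : pairShift (0 : Site d) = id := funext pairShift_zero
        change μ.map (pairShift 0) = μ
        rw [this, Measure.map_id]
      add_mem' := fun {v w} hv hw => by
        have : pairShift (v + w) = pairShift v ∘ pairShift w := funext (pairShift_add v w)
        change μ.map (pairShift (v + w)) = μ
        rw [this, ← Measure.map_map (measurable_pairShift v) (measurable_pairShift w), hw, hv]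
      neg_mem' := fun {v} hv => by
        have : pairShift (-v) ∘ pairShift v = id := funext fun p => by
          rw [Function.comp_apply, ← pairShift_add, neg_add_cancel, pairShift_zero, id]
        change μ.map (pairShift (-v)) = μ
        conv_lhs => rw [← show μ.map (pairShift v) = μ from hv]
        rw [Measure.map_map (measurable_pairShift _) (measurable_pairShift v), this,
          Measure.map_id] }
  refine ⟨measurable_pairShift v, ?_⟩
  change v ∈ H
  rw [← Finset.univ_sum_single v]
  refine sum_mem fun i _ => ?_
  have := H.zsmul_mem (h i).map_eq (v i)
  rwa [← Pi.single_smul, smul_eq_mul, mul_one] at this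

end EA

/-! ### Almost sure convergence of the edge overlaps -/

namespace EA

variable {d : ℕ}

theorem abs_spin (s : Bool) : |spin s| = 1 := by
  cases s <;> simp [spin]

theorem spin_mul_self (s : Bool) : spin s * spin s = 1 := by
  cases s <;> simp [spin]

/-- The product of the four spins of two configurations at the edge `{0, e_i}`. -/
def edgeProduct (i : Fin d) (p : Config d × Config d) : ℝ :=
  spin (p.1 0) * spin (p.1 (Pi.single i 1)) * spin (p.2 0) * spin (p.2 (Pi.single i 1))

theorem measurable_edgeProduct (i : Fin d) : Measurable (edgeProduct i) := by
  have h := measurable_spin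
  unfold edgeProduct
  fun_prop

theorem abs_edgeProduct_le (i : Fin d) (p : Config d × Config d) : |edgeProduct i p| ≤ 1 := by
  simp [edgeProduct, abs_mul, abs_spin]

theorem sum_innerEdges_Icc (a b : Site d) (g : Edge d → ℝ) :
    ∑ e ∈ innerEdges (Finset.Icc a b), g e =
      ∑ i : Fin d, ∑ x ∈ Finset.Icc a (b - Pi.single i 1), g (x, i) := by
  rw [innerEdges, Finset.sum_filter, Finset.sum_product_right]
  refine Finset.sum_congr rfl fun i _ => ?_
  rw [← Finset.sum_filter]
  have h1 : (0 : Site d) ≤ Pi.single i 1 := by simp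
  have hset : (Finset.Icc a b).filter (fun x => Edge.tip (x, i) ∈ Finset.Icc a b) =
      Finset.Icc a (b - Pi.single i 1) := by
    ext x
    rw [Finset.mem_filter]
    simp only [Finset.mem_Icc, Edge.tip, le_sub_iff_add_le]
    exact ⟨fun h => ⟨h.1.1, h.2.2⟩, fun h => ⟨⟨h.1, (le_add_of_nonneg_right h1).trans h.2⟩,
      h.1.trans (le_add_of_nonneg_right h1), h.2⟩⟩
  rw [hset]

/-- An edge in direction `i` lies in `[a, b]` exactly when its base point lies in the box shortened
by one in that direction. The overlap is thus a weighted mean of spatial averages over the shortened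
boxes. -/
theorem windowOverlap_Icc (a b : Site d) (p : Config d × Config d) :
    windowOverlap (Finset.Icc a b) p.1 p.2 =
      (∑ i : Fin d, ((Finset.Icc a (b - Pi.single i 1)).card : ℝ))⁻¹ *
        ∑ i : Fin d, (Finset.Icc a (b - Pi.single i 1)).card *
          shiftAverage pairShift (Finset.Icc a (b - Pi.single i 1)) (edgeProduct i) p := by
  have hcard : ((innerEdges (Finset.Icc a b)).card : ℝ) =
      ∑ i : Fin d, ((Finset.Icc a (b - Pi.single i 1)).card : ℝ) := by
    simpa using sum_innerEdges_Icc a b fun _ => 1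
  rw [windowOverlap, hcard, sum_innerEdges_Icc]
  congr 1
  refine Finset.sum_congr rfl fun i _ => ?_
  rcases (Finset.Icc a (b - Pi.single i 1)).eq_empty_or_nonempty with h | h
  · simp [h]
  · rw [shiftAverage, mul_inv_cancel_left₀ (by exact_mod_cast h.card_ne_zero)]
    simp [edgeProduct, pairShift, Edge.tip, add_comm]

theorem card_Icc_sub_single {a b : Site d} (i : Fin d) (h : a i ≤ b i) :
    ((Finset.Icc a (b - Pi.single i 1)).card : ℝ) =
      (1 - (((b i - a i : ℤ) : ℝ) + 1)⁻¹) * (Finset.Icc a b).card := by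
  rw [Pi.card_Icc, Pi.card_Icc, ← Finset.mul_prod_erase _ _ (Finset.mem_univ i),
    ← Finset.mul_prod_erase Finset.univ (fun j => (Finset.Icc (a j) (b j)).card)
      (Finset.mem_univ i)]
  have h1 : ∏ j ∈ Finset.univ.erase i, (Finset.Icc (a j) ((b - Pi.single i 1 : Site d) j)).card =
      ∏ j ∈ Finset.univ.erase i, (Finset.Icc (a j) (b j)).card :=
    Finset.prod_congr rfl fun j hj => by simp [Finset.ne_of_mem_erase hj]
  have h2 : ((Finset.Icc (a i) (b i)).card : ℝ) = ((b i - a i : ℤ) : ℝ) + 1 := by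
    rw [Int.card_Icc, ← Int.cast_natCast, Int.toNat_of_nonneg (by omega)]
    push_cast
    ring
  have h3 : ((Finset.Icc (a i) ((b - Pi.single i 1 : Site d) i)).card : ℝ) = ((b i - a i : ℤ) : ℝ) := by
    rw [Int.card_Icc, ← Int.cast_natCast, Int.toNat_of_nonneg (by simp; omega)]
    simp
  have h4 : (0 : ℝ) ≤ ((b i - a i : ℤ) : ℝ) := by exact_mod_cast sub_nonneg.2 h
  rw [h1, Nat.cast_mul, Nat.cast_mul, h2, h3]
  generalize ((b i - a i : ℤ) : ℝ) = t at h4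
  have h5 : t + 1 ≠ 0 := by positivity
  field_simp
  ring

theorem tendsto_fst_apply (i : Fin d) :
    Tendsto (fun q : Site d × Site d => q.1 i) (atBot ×ˢ atTop) atBot := by
  refine tendsto_atBot.2 fun c => ?_
  filter_upwards [tendsto_fst.eventually_le_atBot (fun _ => c)] with q hq
  exact hq i

theorem tendsto_snd_apply (i : Fin d) :
    Tendsto (fun q : Site d × Site d => q.2 i) (atBot ×ˢ atTop) atTop := by
  refine tendsto_atTop.2 fun c => ?_
  filter_upwards [tendsto_snd.eventually_ge_atTop (fun _ => c)] with q hq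
  exact hq i

theorem tendsto_card_ratio (i : Fin d) :
    Tendsto (fun q : Site d × Site d => 1 - (((q.2 i - q.1 i : ℤ) : ℝ) + 1)⁻¹)
      (atBot ×ˢ atTop) (𝓝 1) := by
  have h1 : Tendsto (fun q : Site d × Site d => q.2 i - q.1 i) (atBot ×ˢ atTop) atTop := by
    refine tendsto_atTop.2 fun c => ?_
    filter_upwards [(tendsto_fst_apply i).eventually_le_atBot 0,
      (tendsto_snd_apply i).eventually_ge_atTop c] with q h1 h2
    omega
  have h2 := tendsto_inv_atTop_zero.comp
    (tendsto_atTop_add_const_right _ (1 : ℝ) (tendsto_intCast_atTop_atTop.comp h1))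
  simpa [Function.comp_def] using tendsto_const_nhds.sub h2

/-- The edge overlap of two configurations converges if the spatial averages of the products of
spins at the edges in each direction do. -/
theorem exists_tendsto_windowOverlap (hd : 1 ≤ d) {p : Config d × Config d}
    (h : ∀ i : Fin d, ∃ c, Tendsto (fun q : Site d × Site d =>
      shiftAverage pairShift (Finset.Icc q.1 (q.2 - Pi.single i 1)) (edgeProduct i) p)
      (atBot ×ˢ atTop) (𝓝 c)) :
    ∃ c, Tendsto (fun W => windowOverlap W p.1 p.2) (boxes d) (𝓝 c) := by
  choose c hc using h
  -- After division by the volume of the box, each direction has asymptotic weight `1`, so the limit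
  -- is the plain mean of the `c i`.
  refine ⟨(∑ _ : Fin d, (1 : ℝ))⁻¹ * ∑ i, 1 * c i, tendsto_map'_iff.2 ?_⟩
  have hd0 : (∑ _ : Fin d, (1 : ℝ)) ≠ 0 := by
    simp
    omega
  refine (((tendsto_finsetSum _ fun i _ => tendsto_card_ratio i).inv₀ hd0).mul
    (tendsto_finsetSum _ fun i _ => (tendsto_card_ratio i).mul (hc i))).congr' ?_
  filter_upwards [tendsto_fst.eventually_le_atBot (0 : Site d),
    tendsto_snd.eventually_ge_atTop (0 : Site d)] with q h1 h2
  have hle : q.1 ≤ q.2 := h1.trans h2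
  have hne : ((Finset.Icc q.1 q.2).card : ℝ) ≠ 0 := by
    exact_mod_cast (Finset.nonempty_Icc.2 hle).card_ne_zero
  simp only [Function.comp_apply, windowOverlap_Icc, card_Icc_sub_single _ (hle _)]
  simp only [mul_right_comm _ ((Finset.Icc q.1 q.2).card : ℝ), ← Finset.sum_mul]
  rw [mul_inv, mul_mul_mul_comm, inv_mul_cancel₀ hne, mul_one]

theorem ae_tendsto_windowOverlap (hd : 1 ≤ d) {μ : Measure (Config d × Config d)}
    [IsFiniteMeasure μ]
    (h : ∀ i : Fin d, MeasurePreserving (pairShift (Pi.single i 1)) μ μ) :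
    ∀ᵐ p ∂μ, Tendsto (fun W => windowOverlap W p.1 p.2) (boxes d) (𝓝 (edgeOverlap p.1 p.2)) := by
  have hlim : ∀ᵐ p ∂μ, ∀ i : Fin d, ∃ c, Tendsto (fun q : Site d × Site d =>
      shiftAverage pairShift (Finset.Icc q.1 (q.2 - Pi.single i 1)) (edgeProduct i) p)
      (atBot ×ˢ atTop) (𝓝 c) := by
    refine ae_all_iff.2 fun i => averagesConverge_box pairShift_zero pairShift_add
      (measurePreserving_pairShift h) (tendsto_fst_apply) (fun j => ?_) (edgeProduct i)
      (measurable_edgeProduct i) 1 (abs_edgeProduct_le i)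
    simpa only [Pi.sub_apply, sub_eq_add_neg] using
      tendsto_atTop_add_const_right _ (-(Pi.single i 1 : Site d) j) (tendsto_snd_apply j)
  filter_upwards [hlim] with p hp
  exact tendsto_nhds_limUnder (exists_tendsto_windowOverlap hd hp)

/-- Given `J` and `Γ`, two distinct replicas have law `Γ × Γ`, so this is Fubini for null sets. -/
theorem ae_ae_ae_of_ae_pairLaw {ν : ProbabilityMeasure (Coupling d)}
    {κ : Kernel (Coupling d) (ProbabilityMeasure (Config d))} [IsMarkovKernel κ]
    {Φ : Config d × Config d → Prop} (hΦ : MeasurableSet {p | Φ p})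
    (h : ∀ᵐ p ∂(pairLaw ν κ : Measure (Config d × Config d)), Φ p) :
    ∀ᵐ J ∂(ν : Measure (Coupling d)), ∀ᵐ Γ : ProbabilityMeasure (Config d) ∂(κ J),
      ∀ᵐ p ∂((Γ : Measure (Config d)).prod (Γ : Measure (Config d))), Φ p := by
  have hm : Measurable fun σ : ℕ → Config d => (σ 0, σ 1) := by fun_prop
  have h1 : ∀ᵐ q ∂((ν : Measure (Coupling d)) ⊗ₘ replicaKernel κ), Φ (firstPair q) :=
    ae_of_ae_map measurable_firstPair.aemeasurable h
  filter_upwards [Measure.ae_ae_of_ae_compProd h1] with J hJ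
  filter_upwards [Kernel.ae_ae_of_ae_comp hJ] with Γ hΓ
  rw [← replicas_map_pair Γ zero_ne_one, ae_map_iff hm.aemeasurable hΦ]
  exact hΓ

/-! ### Overlap structures -/

theorem ae_replicaKernel_of_ae_prod {κ : Kernel (Coupling d) (ProbabilityMeasure (Config d))}
    {J : Coupling d} {Φ : Config d × Config d → Prop} (hΦ : MeasurableSet {p | Φ p})
    (h : ∀ᵐ Γ : ProbabilityMeasure (Config d) ∂(κ J),
      ∀ᵐ p ∂((Γ : Measure (Config d)).prod (Γ : Measure (Config d))), Φ p) :
    ∀ᵐ σ ∂(replicaKernel κ J), ∀ i j, i ≠ j → Φ (σ i, σ j) := by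
  simp only [ae_all_iff]
  intro i j hij
  have hm : Measurable fun σ : ℕ → Config d => (σ i, σ j) := by fun_prop
  refine Kernel.ae_comp_of_ae_ae (hm hΦ) ?_
  filter_upwards [h] with Γ hΓ
  rw [← replicas_map_pair Γ hij] at hΓ
  exact ae_of_ae_map hm.aemeasurable hΓ

theorem posSemidef_sum_mul {ι E : Type*} (s : Finset E) (v : ι → E → ℝ) :
    (Matrix.of fun i j => ∑ e ∈ s, v i e * v j e).PosSemidef := by
  refine ⟨Matrix.IsHermitian.ext fun i j => by simp [mul_comm], fun x => ?_⟩
  have h : (x.sum fun i xi => x.sum fun j xj =>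
      star xi * (Matrix.of fun i j => ∑ e ∈ s, v i e * v j e) i j * xj) =
      ∑ e ∈ s, (∑ i ∈ x.support, x i * v i e) ^ 2 := by
    simp only [Finsupp.sum, Matrix.of_apply, star_trivial, sq, Finset.mul_sum,
      Finset.sum_mul]
    rw [Finset.sum_comm (s := s)]
    refine Finset.sum_congr rfl fun i _ => ?_
    rw [Finset.sum_comm (s := s)]
    exact Finset.sum_congr rfl fun j _ => Finset.sum_congr rfl fun e _ => by ring
  rw [h]
  exact Finset.sum_nonneg fun _ _ => sq_nonneg _

/-- A normalized Gram matrix of the vectors of spin products along the edges; its diagonal is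
already `1` since spins square to `1`. Without edges the matrix is the identity. -/
theorem posSemidef_overlapMatrix_windowOverlap (W : Finset (Site d)) (σ : ℕ → Config d) :
    (Matrix.of (overlapMatrix (windowOverlap W) σ)).PosSemidef := by
  rcases (innerEdges W).eq_empty_or_nonempty with h | h
  · have : Matrix.of (overlapMatrix (windowOverlap W) σ) = 1 := by
      ext i j
      simp [overlapMatrix, windowOverlap, h, Matrix.one_apply]
    rw [this]
    exact .one
  · have : Matrix.of (overlapMatrix (windowOverlap W) σ) = ((innerEdges W).card : ℝ)⁻¹ •
        Matrix.of fun i j => ∑ e ∈ innerEdges W,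
          (spin (σ i e.1) * spin (σ i e.tip)) * (spin (σ j e.1) * spin (σ j e.tip)) := by
      ext i j
      by_cases hij : i = j
      · subst hij
        simp [overlapMatrix, mul_mul_mul_comm, spin_mul_self, h.card_ne_zero]
      · simp [overlapMatrix, windowOverlap, hij, mul_assoc]
    rw [this]
    exact (posSemidef_sum_mul _ _).smul (by positivity)

theorem posSemidef_of_tendsto {ι : Type*} {l : Filter ι} [l.NeBot] {Q : ι → ℕ → ℕ → ℝ}
    {q : ℕ → ℕ → ℝ} (h : Tendsto Q l (𝓝 q)) (hQ : ∀ n, (Matrix.of (Q n)).PosSemidef) :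
    (Matrix.of q).PosSemidef := by
  have hij : ∀ i j, Tendsto (fun n => Q n i j) l (𝓝 (q i j)) := fun i j =>
    (tendsto_pi_nhds.1 ((tendsto_pi_nhds.1 h) i)) j
  refine ⟨Matrix.IsHermitian.ext fun i j => ?_, fun x => ?_⟩
  · refine tendsto_nhds_unique ((hij j i).congr fun n => ?_) (hij i j)
    simpa using (hQ n).1.apply i j
  -- Each quadratic form involves finitely many entries, so entrywise convergence is enough.
  · refine ge_of_tendsto' (x := l) (f := fun n =>
      x.sum fun i xi => x.sum fun j xj => star xi * Matrix.of (Q n) i j * xj) ?_ fun n => (hQ n).2 x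
    exact tendsto_finsetSum _ fun i _ => tendsto_finsetSum _ fun j _ =>
      ((hij i j).const_mul _).mul_const _

/-- Replicas are i.i.d. given `Γ`, and exchangeability survives mixing over `κ J`. -/
theorem replicaKernel_map_perm (κ : Kernel (Coupling d) (ProbabilityMeasure (Config d)))
    (π : Equiv.Perm ℕ) (J : Coupling d) :
    (replicaKernel κ J).map (fun σ => σ ∘ π) = replicaKernel κ J := by
  have hm : Measurable fun σ : ℕ → Config d => σ ∘ π :=
    measurable_pi_lambda _ fun x => measurable_pi_apply _
  have h : (replicas d).map (fun σ => σ ∘ π) = replicas d := by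
    refine Kernel.ext fun Γ => ?_
    rw [Kernel.map_apply _ hm]
    exact Measure.map_infinitePi_infinitePi_of_inj
      (P := fun _ : ℕ => (Γ : Measure (Config d))) π.injective
  rw [← Kernel.map_apply _ hm, replicaKernel, Kernel.map_comp, h]

theorem measurableSet_posSemidef :
    MeasurableSet {q : ℕ → ℕ → ℝ | (Matrix.of q).PosSemidef} := by
  have hc : IsClosed {q : ℕ → ℕ → ℝ | (Matrix.of q).PosSemidef} := by
    refine isClosed_of_closure_subset fun q hq => ?_
    obtain ⟨u, hu, hlim⟩ := mem_closure_iff_seq_limit.1 hq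
    exact posSemidef_of_tendsto hlim hu
  exact hc.measurableSet

variable {κ : Kernel (Coupling d) (ProbabilityMeasure (Config d))} {J : Coupling d}

theorem tendsto_overlapMatrix {ι : Type*} {l : Filter ι} {R : ι → Config d → Config d → ℝ}
    {R' : Config d → Config d → ℝ} {σ : ℕ → Config d}
    (h : ∀ i j, i ≠ j → Tendsto (fun n => R n (σ i) (σ j)) l (𝓝 (R' (σ i) (σ j)))) :
    Tendsto (fun n => overlapMatrix (R n) σ) l (𝓝 (overlapMatrix R' σ)) := by
  refine tendsto_pi_nhds.2 fun i => tendsto_pi_nhds.2 fun j => ?_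
  by_cases hij : i = j
  · simpa [overlapMatrix, hij] using tendsto_const_nhds
  · simpa [overlapMatrix, hij] using h i j hij

/-- Almost sure convergence of the overlaps of pairs of replicas implies convergence of the overlap
matrices. -/
theorem ae_tendsto_overlapMatrix {ι : Type*} [Countable ι] {l : Filter ι} [l.IsCountablyGenerated]
    {W : ι → Finset (Site d)}
    (h : ∀ᵐ Γ : ProbabilityMeasure (Config d) ∂(κ J),
      ∀ᵐ p ∂((Γ : Measure (Config d)).prod (Γ : Measure (Config d))),
        Tendsto (fun n => windowOverlap (W n) p.1 p.2) l (𝓝 (edgeOverlap p.1 p.2))) :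
    ∀ᵐ σ ∂(replicaKernel κ J), Tendsto (fun n => overlapMatrix (windowOverlap (W n)) σ) l
      (𝓝 (overlapMatrix edgeOverlap σ)) := by
  have hm := measurableSet_tendsto_fun (l := l) (fun n => measurable_windowOverlap (W n))
    measurable_edgeOverlap
  filter_upwards [ae_replicaKernel_of_ae_prod hm h] with σ hσ
  exact tendsto_overlapMatrix hσ

variable [IsMarkovKernel κ]

theorem isROSt_overlapLaw {R : Config d → Config d → ℝ}
    (hR : Measurable fun p : Config d × Config d => R p.1 p.2)
    (h : ∀ᵐ σ ∂(replicaKernel κ J), (Matrix.of (overlapMatrix R σ)).PosSemidef) :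
    IsROSt (overlapLaw κ R hR J) := by
  have hm := measurable_overlapMatrix hR
  refine ⟨?_, fun π _ => ?_⟩
  · change ∀ᵐ q ∂((replicaKernel κ J).map (overlapMatrix R)), _
    rw [ae_map_iff hm.aemeasurable]
    · filter_upwards [h] with σ hσ
      exact ⟨hσ, fun i => if_pos rfl⟩
    · refine measurableSet_posSemidef.inter ?_
      change MeasurableSet {q : ℕ → ℕ → ℝ | ∀ i, q i i = 1}
      rw [Set.ofPred_forall]
      exact .iInter fun i => measurableSet_eq_fun (by fun_prop) measurable_const
  · have hπ : Measurable fun (q : ℕ → ℕ → ℝ) i j => q (π i) (π j) := by fun_prop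
    have hm' : Measurable fun σ : ℕ → Config d => σ ∘ π :=
      measurable_pi_lambda _ fun x => measurable_pi_apply _
    change ((replicaKernel κ J).map (overlapMatrix R)).map _ =
      (replicaKernel κ J).map (overlapMatrix R)
    conv_rhs => rw [← replicaKernel_map_perm κ π J]
    rw [Measure.map_map hπ hm, Measure.map_map hm hm']
    congr 1
    funext σ i j
    simp [overlapMatrix]

theorem tendsto_overlapLaw {ι : Type*} {l : Filter ι} [l.IsCountablyGenerated]
    {R : ι → Config d → Config d → ℝ} {R' : Config d → Config d → ℝ}
    (hR : ∀ n, Measurable fun p : Config d × Config d => R n p.1 p.2)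
    (hR' : Measurable fun p : Config d × Config d => R' p.1 p.2)
    (h : ∀ᵐ σ ∂(replicaKernel κ J),
      Tendsto (fun n => overlapMatrix (R n) σ) l (𝓝 (overlapMatrix R' σ))) :
    Tendsto (fun n => overlapLaw κ (R n) (hR n) J) l (𝓝 (overlapLaw κ R' hR' J)) := by
  rw [ProbabilityMeasure.tendsto_iff_forall_integral_tendsto]
  intro f
  have hmap : ∀ (S : Config d → Config d → ℝ)
      (hS : Measurable fun p : Config d × Config d => S p.1 p.2),
      ∫ q, f q ∂(overlapLaw κ S hS J : Measure (ℕ → ℕ → ℝ)) =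
        ∫ σ, f (overlapMatrix S σ) ∂(replicaKernel κ J) := fun S hS =>
    integral_map (measurable_overlapMatrix hS).aemeasurable
      f.continuous.measurable.aestronglyMeasurable
  simp only [hmap]
  refine tendsto_integral_filter_of_dominated_convergence (fun _ => ‖f‖)
    (Eventually.of_forall fun n => (f.continuous.measurable.comp
      (measurable_overlapMatrix (hR n))).aestronglyMeasurable)
    (Eventually.of_forall fun n => Eventually.of_forall fun σ => f.norm_coe_le_norm _)
    (integrable_const _) ?_
  filter_upwards [h] with σ hσ
  exact (f.continuous.tendsto _).comp hσ

end EA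

theorem mainTheorem8 (d : ℕ) (hd : 1 ≤ d)
    (ρ : ProbabilityMeasure ℝ) (hρ : (ρ : Measure ℝ).map (fun t => -t) = ρ) (β : ℝ)
    (a b : ℕ → EA.Site d) (ha : Tendsto a atTop atBot) (hb : Tendsto b atTop atTop)
    (κ : Kernel (EA.Coupling d) (ProbabilityMeasure (EA.Config d))) [IsMarkovKernel κ]
    (hκ : EA.IsMetastate (EA.couplingLaw d ρ) β a b κ) :
    -- the limit defining `R` exists for almost all pairs of replicas
    (∀ᵐ J ∂(EA.couplingLaw d ρ : Measure (EA.Coupling d)), ∀ᵐ Γ : ProbabilityMeasure (EA.Config d) ∂(κ J),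
      ∀ᵐ p ∂((Γ : Measure (EA.Config d)).prod (Γ : Measure (EA.Config d))),
        Tendsto (fun W => EA.windowOverlap W p.1 p.2) (EA.boxes d)
          (𝓝 (EA.edgeOverlap p.1 p.2))) ∧
    -- `Q^W_J` and `Q_J` are random overlap structures, and `Q^W_J → Q_J` in law
    (∀ᵐ J ∂(EA.couplingLaw d ρ : Measure (EA.Coupling d)),
      (∀ W, EA.IsROSt (EA.windowROSt κ W J)) ∧ EA.IsROSt (EA.limitROSt κ J) ∧
      Tendsto (fun W => EA.windowROSt κ W J) (EA.boxes d) (𝓝 (EA.limitROSt κ J))) ∧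
    -- the same along any other sequence of windows along which the overlaps converge to `R`
    (∀ W : ℕ → Finset (EA.Site d),
      (∀ᵐ J ∂(EA.couplingLaw d ρ : Measure (EA.Coupling d)), ∀ᵐ Γ : ProbabilityMeasure (EA.Config d) ∂(κ J),
        ∀ᵐ p ∂((Γ : Measure (EA.Config d)).prod (Γ : Measure (EA.Config d))),
          Tendsto (fun n => EA.windowOverlap (W n) p.1 p.2) atTop
            (𝓝 (EA.edgeOverlap p.1 p.2))) →
      ∀ᵐ J ∂(EA.couplingLaw d ρ : Measure (EA.Coupling d)),
        Tendsto (fun n => EA.windowROSt κ (W n) J) atTop (𝓝 (EA.limitROSt κ J))) := by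
  have hlim := EA.ae_ae_ae_of_ae_pairLaw
    (measurableSet_tendsto_fun EA.measurable_windowOverlap EA.measurable_edgeOverlap)
    (EA.ae_tendsto_windowOverlap hd
    (EA.measurePreserving_pairShift_single ha hb hκ))
  refine ⟨hlim, ?_, fun W hW => ?_⟩
  · filter_upwards [hlim] with J hJ
    -- The index set is the countable set of all finite windows, with the filter `EA.boxes d`; one
    -- null set of replicas serves the whole limit.
    have hmat := EA.ae_tendsto_overlapMatrix (W := id) hJ
    refine ⟨fun W => EA.isROSt_overlapLaw _ (Eventually.of_forall
      (EA.posSemidef_overlapMatrix_windowOverlap W)), EA.isROSt_overlapLaw _ ?_,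
      EA.tendsto_overlapLaw _ _ hmat⟩
    filter_upwards [hmat] with σ hσ
    exact EA.posSemidef_of_tendsto hσ fun W => EA.posSemidef_overlapMatrix_windowOverlap W σ
  · filter_upwards [hW] with J hJ
    exact EA.tendsto_overlapLaw _ _ (EA.ae_tendsto_overlapMatrix hJ)
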